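/- Let $\Gamma$ be a finite extensive-form game with player set $N=\{1,\dots,n\}$, possibly with a chance player $c$ whose moves have fixed probabilities $f_c(a\mid h)$, and with perfect recall: for every player $i$, any two histories in the same information set of $i$ have the same record of the information sets encountered and the actions taken by $i$. Write $N_c=N\cup\{c\}$, let $A(I)$ be the set of actions at an information set $I$, let $Z$ be the set of terminal histories, and let $u^i_z:Z\to\mathbb R$ be the payoff function of $i\in N$. Equally named actions at different information sets are regarded as different; the information sets of chance are singletons. **Reduced normal form.** A pure strategy $s^i\in S^i$ of player $i$ prescribes exactly one action at each information set of $i$ that is not excluded by the player's own earlier prescriptions, and nothing at the other information sets. A mixed strategy $\sigma^i\in\Xi^i$ is a probability distribution on $S^i$, and $\Xi=\prod_{i\in N}\Xi^i$. Let $u^i(s^i,\sigma^{-i})$ be the expected payoff of $i$ from $s^i$ when the other players use $\sigma^{-i}$ and chance moves according to $f_c$. For $\varepsilon>0$, a profile $\sigma\in\Xi$ with all $\sigma^i(s^i)>0$ is an $\varepsilon$-normal-form proper equilibrium if, for all $i\in N$ and $s^i,\tilde s^i\in S^i$, $$u^i(s^i,\sigma^{-i})<u^i(\tilde s^i,\sigma^{-i})\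 \Longrightarrow\ \sigma^i(s^i)\le\varepsilon\,\sigma^i(\tilde s^i).$$ A profile $\sigma^*\in\Xi$ is a normal-form proper equilibrium if it is a limit point of a sequence of $\varepsilon^k$-normal-form proper equilibria with $\varepsilon^k>0$ and $\varepsilon^k\to0$. **Sequence form.** For $i\in N_c$ and a history $h$, the sequence $\varpi^i_h$ is the set of the actions of $i$ along $h$; $W^i$ is the set of all sequences of $i$. For an information set $I$ of $i$ let $\varpi^i_I=\varpi^i_h$ for $h\in I$, and $\varpi^i_Ia=\varpi^i_I\cup\{a\}$ for $a\in A(I)$. A realization plan $\gamma^i\in\Lambda^i$ of $i\in N$ is a function $\gamma^i:W^i\to[0,\infty)$ with $\gamma^i(\emptyset)=1$ and $\sum_{a\in A(I)}\gamma^i(\varpi^i_Ia)=\gamma^i(\varpi^i_I)$ for every information set $I$ of $i$; $\Lambda=\prod_{i\in N}\Lambda^i$. For chance, $\gamma^c(\varpi^c)$ is the product of the probabilities of the actions in $\varpi^c$. For a sequence profile $\varpi=(\varpi^i)_{i\in N_c}$ put $g^i(\varpi)=u^i_z(h)$ if $\varpi=(\varpi^j_h)_{j\in N_c}$ for some $h\in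 Z$, and $g^i(\varpi)=0$ otherwise. Let $$g^i(\varpi^i,\gamma^{-i})=\sum_{\varpi^{-i}}g^i(\varpi^i,\varpi^{-i})\prod_{j\in N_c\setminus\{i\}}\gamma^j(\varpi^j),\qquad g^i(\gamma)=\sum_{\varpi^i\in W^i}\gamma^i(\varpi^i)\,g^i(\varpi^i,\gamma^{-i}),$$ and let $$g^i_m(\varpi^i,\gamma^{-i})=\max\{g^i(\tilde\gamma^i,\gamma^{-i}):\tilde\gamma^i\in\Lambda^i,\ \tilde\gamma^i(\varpi^i)=1\}$$ be the maximal payoff attainable while committing to $\varpi^i$. For $\varepsilon>0$, a profile $\gamma\in\Lambda$ with all $\gamma^i(\varpi^i)>0$ is an $\varepsilon$-sequence-form proper equilibrium if, for all $i\in N$ and $\varpi^i,\tilde\varpi^i\in W^i$, $$g^i_m(\varpi^i,\gamma^{-i})<g^i_m(\tilde\varpi^i,\gamma^{-i})\ \Longrightarrow\ \gamma^i(\varpi^i)\le\varepsilon\,\gamma^i(\tilde\varpi^i).$$ A profile $\gamma^*\in\Lambda$ is a sequence-form proper equilibrium if it is a limit point of a sequence of $\varepsilon^k$-sequence-form proper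 equilibria with $\varepsilon^k>0$ and $\varepsilon^k\to0$. **Theorem.** Let $\sigma^*\in\Xi$, and let $\gamma^*$ be the realization plan profile induced by $\sigma^*$, that is, for $i\in N$ and $\varpi^i\in W^i$, $\gamma^{*i}(\varpi^i)$ is the sum of $\sigma^{*i}(s^i)$ over the $s^i\in S^i$ that prescribe all actions in $\varpi^i$. Then $\sigma^*$ is a normal-form proper equilibrium of $\Gamma$ if and only if $\gamma^*$ is a sequence-form proper equilibrium of $\Gamma$. -/

import Mathlib

/-! # Finite extensive-form games, their reduced normal form and their sequence form

`N` is the type of (non-chance) players, `α` the type of actions. The acting parties are the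
elements of `Option N`: `some i` is player `i` and `none` is chance. -/

/-- A finite set of histories. A history is the list of the actions taken so far, **most recent
action first**: `a :: h` is the history `h` followed by the action `a`. The set contains the empty
history and is closed under deleting the last action. -/
structure GameTree (α : Type*) where
  /-- the finite set of histories -/
  H : Finset (List α)
  nil_mem : [] ∈ H
  tail_mem : ∀ (a : α) (h : List α), a :: h ∈ H → h ∈ H

namespace GameTree

variable {α : Type*} [DecidableEq α] (T : GameTree α)

/-- `A(h)`, the finite set of actions available after the history `h`. -/
def actions (h : List α) : Finset α :=
  (T.H.biUnion List.toFinset).filter fun a => a :: h ∈ T.H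

theorem mem_actions {h : List α} {a : α} : a ∈ T.actions h ↔ a :: h ∈ T.H := by
  simp only [actions, Finset.mem_filter, Finset.mem_biUnion, List.mem_toFinset]
  exact ⟨fun x => x.2, fun x => ⟨⟨a :: h, x, List.mem_cons_self⟩, x⟩⟩

/-- `Z`, the finite set of terminal histories. -/
def Z : Finset (List α) := T.H.filter fun h => T.actions h = ∅

end GameTree

/-- A finite extensive-form game: a tree of histories, the party moving after each nonterminal
history, the probabilities of the chance moves, the information partitions of the players and
their payoffs. The values of `mover` and `payoff` outside the nonterminal, respectively terminal,
histories are never used. -/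
structure ExtensiveGame (N α : Type*) [DecidableEq N] [DecidableEq α] extends GameTree α where
  /-- the party (`none` is chance) that moves after a nonterminal history -/
  mover : List α → Option N
  /-- `chance h a` is the probability that chance takes the action `a` after `h` -/
  chance : List α → α → ℝ
  chance_nonneg : ∀ h ∈ toGameTree.H, mover h = none → ∀ a ∈ toGameTree.actions h, 0 ≤ chance h a
  chance_sum : ∀ h ∈ toGameTree.H, (toGameTree.actions h).Nonempty → mover h = none →
    ∑ a ∈ toGameTree.actions h, chance h a = 1
  /-- the information partition of each player: a partition of the set of nonterminal histories
  after which the player moves -/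
  info : ∀ i : N, Finpartition
    (toGameTree.H.filter fun h => (toGameTree.actions h).Nonempty ∧ mover h = some i)
  /-- the same actions are available at all histories of an information set -/
  actions_eq : ∀ (i : N), ∀ I ∈ (info i).parts, ∀ h ∈ I, ∀ h' ∈ I,
    toGameTree.actions h = toGameTree.actions h'
  /-- the payoff of each player at each terminal history -/
  payoff : N → List α → ℝ

namespace ExtensiveGame

variable {N α : Type*} [DecidableEq N] [DecidableEq α] (G : ExtensiveGame N α)

/-- The nonterminal histories after which the party `j` moves. -/
def nodes (j : Option N) : Finset (List α) :=
  G.H.filter fun h => (G.actions h).Nonempty ∧ G.mover h = j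

/-- The information set of the party `j` that contains the history `h`. The information sets of
chance are singletons. -/
def cell : Option N → List α → Finset (List α)
  | none, h => {h}
  | some i, h => (G.info i).part h

/-- `R_j(h)`, the record of the experience of the party `j` along the history `h`: the information
sets that `j` encounters and the actions that `j` takes there, in order (most recent first). -/
def record (j : Option N) : List α → List (Finset (List α) × α)
  | [] => []
  | a :: h => if G.mover h = j then (G.cell j h, a) :: record j h else record j h

/-- Perfect recall: histories in the same information set of a player have the same record. -/
def PerfectRecall : Prop :=
  ∀ (i : N), ∀ I ∈ (G.info i).parts, ∀ h ∈ I, ∀ h' ∈ I,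
    G.record (some i) h = G.record (some i) h'

/-! ### The reduced normal form -/

/-- The sequence of the party `j` at the history `h`: the set of the moves of `j` along `h`. A move
is an action together with the information set at which it is taken, so that equally named actions
at different information sets are kept apart. -/
def seqSet (j : Option N) (h : List α) : Finset (Finset (List α) × α) :=
  (G.record j h).toFinset

/-- All moves of player `i`: the pairs of an information set `I` and an action of `A(I)`. -/
def moves (i : N) : Finset (Finset (List α) × α) :=
  (G.nodes (some i)).biUnion fun h => (G.actions h).image fun a => (G.cell (some i) h, a)

/-- The set of moves `s` is (the graph of) a pure strategy of player `i` in the reduced normal form: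
it prescribes exactly one action at each information set that is not excluded by the own earlier
prescriptions of `s`, and no action at any other information set. -/
def IsPure (i : N) (s : Finset (Finset (List α) × α)) : Prop :=
  s ⊆ G.moves i ∧ ∀ h ∈ G.nodes (some i),
    (G.seqSet (some i) h ⊆ s → ∃! a, (G.cell (some i) h, a) ∈ s) ∧
    (∀ a, (G.cell (some i) h, a) ∈ s → G.seqSet (some i) h ⊆ s)

open Classical in
/-- `S^i`, the finite set of pure strategies of player `i` in the reduced normal form. -/
noncomputable def pureStrategies (i : N) : Finset (Finset (Finset (List α) × α)) :=
  (G.moves i).powerset.filter (G.IsPure i)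

/-- The type of pure strategies of player `i` in the reduced normal form. -/
abbrev Pure (i : N) : Type _ := {s // s ∈ G.pureStrategies i}

/-- The type of pure strategies of chance: an action at each chance history. -/
abbrev ChancePure : Type _ := ∀ h : {h // h ∈ G.nodes none}, {a // a ∈ G.actions h.1}

open Classical in
/-- The product of the indicators that the pure strategy profile `(s, sc)` takes the actions of a
history; it is `1` if the history is played under `(s, sc)` and `0` if not. -/
noncomputable def played (s : ∀ i, G.Pure i) (sc : G.ChancePure) : List α → ℝ
  | [] => 1
  | a :: h => played s sc h *
      match G.mover h with
      | none => if ∃ hh : h ∈ G.nodes none, (sc ⟨h, hh⟩ : α) = a then 1 else 0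
      | some i => if (G.cell (some i) h, a) ∈ (s i).1 then 1 else 0

/-- `u^i(s)`, the payoff of player `i` under a pure strategy profile (chance included). -/
noncomputable def purePayoff (i : N) (s : ∀ i, G.Pure i) (sc : G.ChancePure) : ℝ :=
  ∑ h ∈ G.Z, G.payoff i h * G.played s sc h

/-- `σ^c`, the mixed strategy of chance. -/
noncomputable def chanceMixed (sc : G.ChancePure) : ℝ :=
  ∏ h : {h // h ∈ G.nodes none}, G.chance h.1 (sc h).1

/-- Real-valued functions on the pure strategies of the players; the mixed strategy profiles are
those in `mixedProfiles`. -/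
abbrev MixedProfile : Type _ := ∀ i : N, G.Pure i → ℝ

/-- `Ξ`, the set of mixed strategy profiles. -/
def mixedProfiles : Set G.MixedProfile :=
  {σ | ∀ i, (∀ s, 0 ≤ σ i s) ∧ ∑ s, σ i s = 1}

/-- `u^i(s^i, σ^{-i})`, the expected payoff of player `i` from the pure strategy `si` when the other
players play `σ` and chance plays `σ^c`. It does not depend on `σ i`. -/
noncomputable def mixedPayoff [Fintype N] (i : N) (si : G.Pure i) (σ : G.MixedProfile) : ℝ :=
  ∑ s : (∀ j, G.Pure j) with s i = si, ∑ sc : G.ChancePure,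
    G.purePayoff i s sc * (G.chanceMixed sc * ∏ j ∈ Finset.univ.erase i, σ j (s j))

/-- `σ` is an `ε`-normal-form proper equilibrium. -/
def IsEpsNormalFormProper [Fintype N] (ε : ℝ) (σ : G.MixedProfile) : Prop :=
  σ ∈ G.mixedProfiles ∧ (∀ i s, 0 < σ i s) ∧
    ∀ (i : N) (s s' : G.Pure i), G.mixedPayoff i s σ < G.mixedPayoff i s' σ → σ i s ≤ ε * σ i s'

/-- `σ` is a normal-form proper equilibrium: a limit point of a sequence of `ε k`-normal-form proper
equilibria with `ε k > 0` tending to `0`. -/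
def IsNormalFormProper [Fintype N] (σ : G.MixedProfile) : Prop :=
  σ ∈ G.mixedProfiles ∧ ∃ (ε : ℕ → ℝ) (τ : ℕ → G.MixedProfile),
    (∀ k, 0 < ε k) ∧ Filter.Tendsto ε Filter.atTop (nhds 0) ∧
    (∀ k, G.IsEpsNormalFormProper (ε k) (τ k)) ∧ MapClusterPt σ Filter.atTop τ

/-! ### The sequence form -/

/-- `W^j`, the type of sequences of the party `j`. -/
abbrev Seq (j : Option N) : Type _ := {w // w ∈ G.H.image (G.seqSet j)}

/-- The sequence of the party `j` at a history. -/
def seqAt (j : Option N) (h : List α) (hh : h ∈ G.H) : G.Seq j :=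
  ⟨G.seqSet j h, Finset.mem_image_of_mem _ hh⟩

/-- Real-valued functions on the sequences of the players; the realization plan profiles are those
in `planProfiles`. -/
abbrev PlanProfile : Type _ := ∀ i : N, G.Seq (some i) → ℝ

/-- `Λ^i`, the set of realization plans of player `i`. At a history `h` in an information set `I` of
player `i`, `seqAt (some i) h` is the sequence leading to `I`, and the sequence at `a :: h` is its
extension by the action `a` at `I`. -/
def plans (i : N) : Set (G.Seq (some i) → ℝ) :=
  {γ | γ (G.seqAt (some i) [] G.nil_mem) = 1 ∧ (∀ w, 0 ≤ γ w) ∧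
    ∀ h (hh : h ∈ G.nodes (some i)),
      ∑ a : {a // a ∈ G.actions h}, γ (G.seqAt (some i) (a.1 :: h) (G.mem_actions.1 a.2)) =
        γ (G.seqAt (some i) h (Finset.mem_filter.1 hh).1)}

/-- `Λ`, the set of realization plan profiles. -/
def planProfiles : Set G.PlanProfile := {γ | ∀ i, γ i ∈ G.plans i}

/-- `γ^c`, the realization plan of chance: the product of the probabilities of the moves in the
sequence. A move of chance is a pair of a singleton `{h}` and an action `a`, of probability
`chance h a`. -/
noncomputable def chancePlan (w : G.Seq none) : ℝ :=
  ∏ m ∈ w.1, ∏ h ∈ m.1, G.chance h m.2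

/-- A realization plan profile together with the realization plan of chance. -/
noncomputable def withChance (γ : G.PlanProfile) : ∀ j : Option N, G.Seq j → ℝ
  | none => G.chancePlan
  | some i => γ i

open Classical in
/-- `g^i(ϖ)`, the payoff of player `i` at a sequence profile (chance included): the payoff at the
terminal history that defines the profile, and `0` if there is none. (With perfect recall at most
one terminal history defines a given profile.) -/
noncomputable def seqPayoff (i : N) (w : ∀ j, G.Seq j) : ℝ :=
  ∑ h ∈ G.Z with ∀ j, (w j).1 = G.seqSet j h, G.payoff i h

/-- `g^i(ϖ^i, γ^{-i})`, the expected payoff of player `i` at the sequence `wi`. It does not depend on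
`γ i`. -/
noncomputable def seqExpPayoff [Fintype N] (i : N) (wi : G.Seq (some i)) (γ : G.PlanProfile) : ℝ :=
  ∑ w : (∀ j, G.Seq j) with w (some i) = wi,
    G.seqPayoff i w * ∏ j ∈ Finset.univ.erase (some i), G.withChance γ j (w j)

/-- `g^i(γi, γ^{-i})`, the expected payoff of player `i` at the realization plan `γi`. -/
noncomputable def planPayoff [Fintype N] (i : N) (γi : G.Seq (some i) → ℝ) (γ : G.PlanProfile) : ℝ :=
  ∑ w, γi w * G.seqExpPayoff i w γ

/-- `g^i_m(ϖ^i, γ^{-i})`, the maximal expected payoff of player `i` attainable while committing to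
the sequence `w`. (With perfect recall the supremum is over a nonempty compact set, hence
a maximum.) -/
noncomputable def maxPayoff [Fintype N] (i : N) (w : G.Seq (some i)) (γ : G.PlanProfile) : ℝ :=
  sSup ((fun γi => G.planPayoff i γi γ) '' {γi | γi ∈ G.plans i ∧ γi w = 1})

/-- `γ` is an `ε`-sequence-form proper equilibrium. -/
def IsEpsSequenceFormProper [Fintype N] (ε : ℝ) (γ : G.PlanProfile) : Prop :=
  γ ∈ G.planProfiles ∧ (∀ i w, 0 < γ i w) ∧
    ∀ (i : N) (w w' : G.Seq (some i)), G.maxPayoff i w γ < G.maxPayoff i w' γ → γ i w ≤ ε * γ i w'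

/-- `γ` is a sequence-form proper equilibrium: a limit point of a sequence of `ε k`-sequence-form
proper equilibria with `ε k > 0` tending to `0`. -/
def IsSequenceFormProper [Fintype N] (γ : G.PlanProfile) : Prop :=
  γ ∈ G.planProfiles ∧ ∃ (ε : ℕ → ℝ) (η : ℕ → G.PlanProfile),
    (∀ k, 0 < ε k) ∧ Filter.Tendsto ε Filter.atTop (nhds 0) ∧
    (∀ k, G.IsEpsSequenceFormProper (ε k) (η k)) ∧ MapClusterPt γ Filter.atTop η

/-! ### From mixed strategies to realization plans -/

/-- `γ(σ)`, the realization plan profile induced by `σ`: the probability of a sequence is the total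
probability of the pure strategies that take all of its moves. -/
noncomputable def inducedPlan (σ : G.MixedProfile) : G.PlanProfile :=
  fun i w => ∑ s : G.Pure i, (if w.1 ⊆ s.1 then 1 else 0) * σ i s

/-- The set `T` of the pairs of a mixed strategy profile and the realization plan profile induced
by it. -/
def inducedPairs : Set (G.MixedProfile × G.PlanProfile) :=
  {p | p.1 ∈ G.mixedProfiles ∧ p.2 = G.inducedPlan p.1}

end ExtensiveGame

/-
By perfect recall the sequences of a player form a tree of decisions. Against a fixed profile of the
others, backward induction attaches to every sequence a loss `L ≥ 0`, with a lossless action at each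
information set, so that a pure strategy earns the optimal value minus the total loss of its
sequences, and committing to a sequence costs exactly the loss accumulated along it. Both notions of
`ε`-properness therefore say the same thing: what loses more is smaller by a factor `ε`.

From mixed strategies to realization plans, every strategy playing the costlier of two sequences is
worse than the best strategy playing the cheaper one, so an `ε`-proper mixed strategy induces an
`|S| ε`-proper plan.

Conversely, given a proper plan `γ` close to the plan of `σ`, one needs a proper mixed strategy
close to `σ` that realizes `γ`. Keep `θ σ` with `θ < 1` close to `1`, give all strategies small
weights ordered by their losses, and decompose the remaining steep flow greedily into strategies
that lose nothing off one of their sequences; the weight of such a strategy is controlled by `γ`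
at that sequence, which is what properness of `γ` bounds.
-/

open Filter Topology

section General

variable {X : Type*}

/-- `f` is `ε`-proper for `cost` if raising the cost cuts the value of `f` by the factor `ε`. Both
notions of `ε`-proper equilibrium are of this form, the cost being minus the payoff. -/
def IsEpsProper (ε : ℝ) (cost f : X → ℝ) : Prop :=
  ∀ ⦃x y⦄, cost x < cost y → f y ≤ ε * f x

theorem IsEpsProper.mono {ε ε' : ℝ} {cost f : X → ℝ} (h : IsEpsProper ε cost f) (hε : ε ≤ ε')
    (hf : ∀ x, 0 ≤ f x) : IsEpsProper ε' cost f :=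
  fun x _ hxy => (h hxy).trans (mul_le_mul_of_nonneg_right hε (hf x))

theorem isEpsProper_iff_of_eq_sub {ε V : ℝ} {u cost f : X → ℝ} (hu : ∀ x, u x = V - cost x) :
    IsEpsProper ε cost f ↔ ∀ x y, u x < u y → f x ≤ ε * f y := by
  simp only [IsEpsProper, hu, sub_lt_sub_iff_left]
  exact forall_comm

/-- The value `c p` is placed between `γ` at the cheapest `w` that are still more costly than `p`
and the least `γ` among the other `w`, with one factor `κ` of room per competitor of `p`. -/
theorem IsEpsProper.exists_interpolation {W P : Type*} [Finite W] [Fintype P] {κ : ℝ}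
    (hκ : 0 < κ) (hκ1 : κ ≤ 1) {γ : W → ℝ} (hγ : ∀ w, 0 < γ w) {a : P → ℝ} {b : W → ℝ}
    (hab : ∀ p, ∃ w, b w ≤ a p) (h : IsEpsProper (κ ^ (Fintype.card P + 1)) b γ) :
    ∃ c : P → ℝ, (∀ p, 0 < c p) ∧ IsEpsProper κ a c ∧
      (∀ p w, b w ≤ a p → c p ≤ κ * γ w) ∧ ∀ p w, a p < b w → γ w ≤ κ * c p := by
  classical
  choose y hy hmin using fun p =>
    Set.exists_min_image {w | b w ≤ a p} γ (Set.toFinite _) (hab p)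
  set r : P → ℕ := fun p => (Finset.univ.filter fun q => a q < a p).card
  have hr : ∀ ⦃p q⦄, a p < a q → r p < r q := fun p q hpq =>
    Finset.card_lt_card <| Finset.ssubset_iff_of_subset
      (Finset.monotone_filter_right _ fun _ _ h => h.trans hpq) |>.2 ⟨p, by simpa using hpq⟩
  have hr_lt : ∀ p, r p < Fintype.card P := fun p =>
    Finset.card_lt_univ_of_notMem (x := p) (by simp)
  refine ⟨fun p => κ ^ (r p + 1) * γ (y p), fun p => mul_pos (pow_pos hκ _) (hγ _),
    fun p q hpq => ?_, fun p w hw => ?_, fun p w hw => ?_⟩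
  · calc κ ^ (r q + 1) * γ (y q) ≤ κ ^ (r p + 1 + 1) * γ (y p) :=
          mul_le_mul (pow_le_pow_of_le_one hκ.le hκ1 (Nat.succ_le_succ (hr hpq)))
            (hmin q _ ((hy p).trans hpq.le)) (hγ _).le (pow_pos hκ _).le
      _ = κ * (κ ^ (r p + 1) * γ (y p)) := by ring
  · exact mul_le_mul (pow_le_of_le_one hκ.le hκ1 (Nat.succ_ne_zero _)) (hmin p w hw)
      (hγ _).le hκ.le
  · calc γ w ≤ κ ^ (Fintype.card P + 1) * γ (y p) := h ((hy p).trans_lt hw)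
      _ ≤ κ ^ (r p + 1 + 1) * γ (y p) := mul_le_mul_of_nonneg_right
          (pow_le_pow_of_le_one hκ.le hκ1 (Nat.succ_le_succ (hr_lt p))) (hγ _).le
      _ = κ * (κ ^ (r p + 1) * γ (y p)) := by ring

theorem eventually_mul_lt_nhdsGT_zero (c : ℝ) {ε : ℝ} (hε : 0 < ε) :
    ∀ᶠ δ in 𝓝[>] (0 : ℝ), c * δ < ε := by
  have h : Tendsto (fun δ : ℝ => c * δ) (𝓝 0) (𝓝 (c * 0)) := tendsto_id.const_mul c
  exact (h.mono_left nhdsWithin_le_nhds).eventually_lt_const (by rwa [mul_zero])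

theorem eventually_smul_le_of_lt_one [Finite X] {f : X → ℝ} (hf : 0 ≤ f) {θ : ℝ} (hθ : θ < 1) :
    ∀ᶠ g in 𝓝 f, 0 ≤ g → θ • f ≤ g := by
  have hx : ∀ x, ∀ᶠ g : X → ℝ in 𝓝 f, 0 ≤ g → θ * f x ≤ g x := fun x => by
    rcases (hf x).eq_or_lt with h0 | h0
    · exact .of_forall fun g hg => by simpa [← h0] using hg x
    · filter_upwards [(continuous_apply x).tendsto f |>.eventually_const_lt
        (mul_lt_of_lt_one_left h0 hθ)] with g hg _ using hg.le
  filter_upwards [eventually_all.2 hx] with g hg h0 x using hg x h0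

theorem abs_sub_le_of_smul_le_of_mem_stdSimplex [Fintype X] {σ τ : X → ℝ}
    (hσ : σ ∈ stdSimplex ℝ X) (hτ : τ ∈ stdSimplex ℝ X) {θ : ℝ} (hθ : θ ≤ 1) (h : θ • σ ≤ τ)
    (x : X) : |τ x - σ x| ≤ 1 - θ := by
  have hσx : σ x ≤ 1 := hσ.2 ▸ Finset.single_le_sum (fun y _ => hσ.1 y) (Finset.mem_univ x)
  have hx : θ * σ x ≤ τ x := h x
  have hsum : τ x - θ * σ x ≤ 1 - θ := by
    calc τ x - θ * σ x ≤ ∑ y, (τ y - θ * σ y) := Finset.single_le_sum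
          (f := fun y => τ y - θ * σ y) (fun y _ => sub_nonneg.2 (h y)) (Finset.mem_univ x)
      _ = 1 - θ := by rw [Finset.sum_sub_distrib, ← Finset.mul_sum, hσ.2, hτ.2, mul_one]
  rw [abs_le]
  constructor <;> nlinarith [hσ.1 x]

theorem eventually_forall_smul_le_mem_of_mem_nhds [Fintype X] {σ : X → ℝ}
    (hσ : σ ∈ stdSimplex ℝ X) {U : Set (X → ℝ)} (hU : U ∈ 𝓝 σ) :
    ∀ᶠ θ in 𝓝[<] (1 : ℝ), ∀ τ ∈ stdSimplex ℝ X, θ • σ ≤ τ → τ ∈ U := by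
  obtain ⟨r, hr, hball⟩ := Metric.mem_nhds_iff.1 hU
  filter_upwards [Ioo_mem_nhdsLT (sub_lt_self 1 hr)] with θ hθ τ hτ hle
  refine hball ((dist_pi_lt_iff hr).2 fun x => ?_)
  exact (abs_sub_le_of_smul_le_of_mem_stdSimplex hσ hτ hθ.2.le hle x).trans_lt
    (sub_lt_comm.1 hθ.1)

theorem exists_mapClusterPt_iff_frequently [TopologicalSpace X] [FirstCountableTopology X]
    {P : ℝ → X → Prop} (hP : ∀ ⦃ε ε' y⦄, ε ≤ ε' → P ε y → P ε' y) {x : X} :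
    (∃ (ε : ℕ → ℝ) (y : ℕ → X), (∀ k, 0 < ε k) ∧ Tendsto ε atTop (𝓝 0) ∧
      (∀ k, P (ε k) (y k)) ∧ MapClusterPt x atTop y) ↔ ∀ ε > 0, ∃ᶠ y in 𝓝 x, P ε y := by
  constructor
  · rintro ⟨ε, y, -, hε, hy, hx⟩ δ hδ
    refine frequently_iff.2 fun {U} hU => ?_
    obtain ⟨k, hkU, hk⟩ := ((mapClusterPt_iff_frequently.1 hx U hU).and_eventually
      (hε.eventually_le_const hδ)).exists
    exact ⟨y k, hkU, hP hk (hy k)⟩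
  · intro h
    obtain ⟨U, hU⟩ := (𝓝 x).exists_antitone_basis
    have hε : ∀ k : ℕ, (0 : ℝ) < 1 / (k + 1) := fun k => Nat.one_div_pos_of_nat
    choose y hyU hy using fun k => frequently_iff.1 (h _ (hε k)) (hU.mem k)
    exact ⟨_, y, hε, tendsto_one_div_add_atTop_nhds_zero_nat, hy, (hU.tendsto hyU).mapClusterPt⟩

theorem sum_prod_filter_apply_eq {ι R : Type*} [Fintype ι] [DecidableEq ι] {β : ι → Type*}
    [∀ i, Fintype (β i)] [∀ i, DecidableEq (β i)] [CommSemiring R] (f : ∀ i, β i → R) (i : ι)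
    (b : β i) :
    ∑ s : (∀ j, β j) with s i = b, ∏ j, f j (s j) =
      f i b * ∏ j ∈ Finset.univ.erase i, ∑ c, f j c := by
  rw [← Fintype.piFinset_univ, ← Fintype.piFinset_update_singleton_eq_filter_piFinset_eq _ i
    (Finset.mem_univ b), ← Finset.prod_univ_sum,
    ← Finset.mul_prod_erase _ _ (Finset.mem_univ i), Function.update_self, Finset.sum_singleton]
  refine congrArg _ (Finset.prod_congr rfl fun j hj => ?_)
  rw [Function.update_of_ne (Finset.ne_of_mem_erase hj)]

theorem sum_indicator_one_mul {ι R : Type*} [Fintype ι] [NonAssocSemiring R] (S : Finset ι)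
    (f : ι → R) : ∑ x, (S : Set ι).indicator 1 x * f x = ∑ x ∈ S, f x := by
  classical
  simp only [Set.indicator_apply, Finset.mem_coe, Pi.one_apply, ite_mul, one_mul, zero_mul,
    Finset.sum_ite_mem, Finset.univ_inter]

end General

section Realization

variable {W P : Type*} [Fintype P] {act : P → Finset W}

/-- The realization plan of a mixed strategy `τ`, where `act p` is the set of the sequences played
by the pure strategy `p`. -/
noncomputable def realization (act : P → Finset W) : (P → ℝ) →ₗ[ℝ] (W → ℝ) :=
  Fintype.linearCombination ℝ fun p => (act p : Set W).indicator 1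

theorem realization_apply [DecidableEq W] (τ : P → ℝ) (w : W) :
    realization act τ w = ∑ p with w ∈ act p, τ p := by
  simp [realization, Fintype.linearCombination_apply, Set.indicator_apply, Finset.sum_filter]

theorem realization_single [DecidableEq P] (p : P) (m : ℝ) :
    realization act (Pi.single p m) = m • (act p : Set W).indicator 1 :=
  Fintype.linearCombination_apply_single ..

theorem realization_nonneg {τ : P → ℝ} (hτ : 0 ≤ τ) : 0 ≤ realization act τ := by
  classical
  intro w
  rw [realization_apply]
  exact Finset.sum_nonneg fun p _ => hτ p

theorem le_realization {τ : P → ℝ} (hτ : 0 ≤ τ) {p : P} {w : W} (hw : w ∈ act p) :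
    τ p ≤ realization act τ w := by
  classical
  rw [realization_apply]
  exact Finset.single_le_sum (f := τ) (fun q _ => hτ q) (by simpa using hw)

theorem realization_le {τ : P → ℝ} {w : W} {c : ℝ} (hc : 0 ≤ c)
    (h : ∀ p, w ∈ act p → τ p ≤ c) : realization act τ w ≤ Fintype.card P * c := by
  classical
  rw [realization_apply, ← nsmul_eq_mul]
  calc ∑ p with w ∈ act p, τ p
      ≤ (Finset.univ.filter fun p => w ∈ act p).card • c :=
        Finset.sum_le_card_nsmul _ _ _ fun p hp => h p (Finset.mem_filter.1 hp).2
    _ ≤ Fintype.card P • c := nsmul_le_nsmul_left hc (Finset.card_le_univ _)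

end Realization

/-- The decision problem of a single player with perfect recall. `W` is the set of the sequences of
the player, ordered by extension, and `J` the set of the information sets; `par j` is the sequence
that leads to `j` and `kids j` the set of its extensions by the actions at `j`. -/
structure DecisionTree (W J : Type*) [PartialOrder W] where
  root : W
  par : J → W
  kids : J → Finset W
  root_le : ∀ w, root ≤ w
  le_iff : ∀ j, ∀ w ∈ kids j, ∀ x, x ≤ w ↔ x = w ∨ x ≤ par j
  not_le : ∀ j, ∀ w ∈ kids j, ¬ w ≤ par j
  exists_kid : ∀ w, w ≠ root → ∃ j, w ∈ kids j
  kids_unique : ∀ j j' w, w ∈ kids j → w ∈ kids j' → j = j'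
  kids_nonempty : ∀ j, (kids j).Nonempty

namespace DecisionTree

variable {W J : Type*} [PartialOrder W] (D : DecisionTree W J)

theorem par_lt {j : J} {w : W} (hw : w ∈ D.kids j) : D.par j < w :=
  lt_of_le_not_ge ((D.le_iff j w hw _).2 (Or.inr le_rfl)) (D.not_le j w hw)

theorem root_notMem_kids (j : J) : D.root ∉ D.kids j := fun h => D.not_le j _ h (D.root_le _)

theorem induction [Finite W] {P : W → Prop} (root : P D.root)
    (kid : ∀ j, ∀ v ∈ D.kids j, P (D.par j) → P v) (w : W) : P w := by
  induction w using WellFoundedLT.induction with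
  | ind w ih =>
    by_cases h : w = D.root
    · exact h ▸ root
    · obtain ⟨j, hj⟩ := D.exists_kid w h
      exact kid j w hj (ih _ (D.par_lt hj))

theorem eq_of_mem_kids_of_le [Finite W] {j : J} {x y w : W} (hx : x ∈ D.kids j)
    (hy : y ∈ D.kids j) (hxw : x ≤ w) (hyw : y ≤ w) : x = y := by
  induction w using D.induction with
  | root => exact absurd (le_antisymm hxw (D.root_le x) ▸ hx) (D.root_notMem_kids j)
  | kid k w hw ih =>
    rcases (D.le_iff k w hw x).1 hxw with rfl | hxk <;>
      rcases (D.le_iff k _ hw y).1 hyw with rfl | hyk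
    · rfl
    · obtain rfl := D.kids_unique _ _ _ hx hw
      exact absurd hyk (D.not_le _ _ hy)
    · obtain rfl := D.kids_unique _ _ _ hy hw
      exact absurd hxk (D.not_le _ _ hx)
    · exact ih hxk hyk

theorem sum_eq_root_add_sum_kids [Fintype W] [Fintype J] (f : W → ℝ) :
    ∑ w, f w = f D.root + ∑ j, ∑ w ∈ D.kids j, f w := by
  classical
  have hdisj : Pairwise (Function.onFun Disjoint D.kids) := fun j k hjk =>
    Finset.disjoint_left.2 fun w hj hk => hjk (D.kids_unique _ _ _ hj hk)
  have huniv : insert D.root (Finset.univ.biUnion D.kids) = Finset.univ := by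
    ext w
    simpa using or_iff_not_imp_left.2 (D.exists_kid w)
  rw [← Finset.sum_biUnion fun j _ k _ => @hdisj j k, ← Finset.sum_insert, huniv]
  simp [D.root_notMem_kids]

/-- The flows on the tree: the solutions of the linear equations of the sequence form. The
realization plans are the nonnegative flows with value `1` at the root. -/
def flows : Submodule ℝ (W → ℝ) where
  carrier := {ρ | ∀ j, ∑ w ∈ D.kids j, ρ w = ρ (D.par j)}
  add_mem' hρ hρ' j := by simp [Finset.sum_add_distrib, hρ j, hρ' j]
  zero_mem' j := by simp
  smul_mem' c ρ hρ j := by simp [← Finset.mul_sum, hρ j]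

variable {D}

theorem le_of_mem_flows_of_le [Finite W] {ρ : W → ℝ} (hρ : ρ ∈ D.flows) (h0 : 0 ≤ ρ) {x w : W}
    (hxw : x ≤ w) : ρ w ≤ ρ x := by
  induction w using D.induction with
  | root => rw [le_antisymm hxw (D.root_le x)]
  | kid k w hw ih =>
    rcases (D.le_iff k w hw x).1 hxw with rfl | hxk
    · rfl
    · calc ρ w ≤ ∑ y ∈ D.kids k, ρ y := Finset.single_le_sum (fun y _ => h0 y) hw
        _ = ρ (D.par k) := hρ k
        _ ≤ ρ x := ih hxk

/-! ### Losses -/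

variable (D) in
/-- A loss function: `L w` is the nonnegative loss incurred by the last action of `w`, and each
information set has an action without loss. -/
structure IsLoss (L : W → ℝ) : Prop where
  nonneg : ∀ w, 0 ≤ L w
  root : L D.root = 0
  exists_zero : ∀ j, ∃ w ∈ D.kids j, L w = 0

variable (D) in
theorem exists_value [Finite W] [Fintype J] [DecidableEq W] (g : W → ℝ) :
    ∃ V : W → ℝ, ∀ w, V w = g w +
      ∑ j with D.par j = w, (D.kids j).sup' (D.kids_nonempty j) V := by
  classical
  have wf : WellFounded fun a b : W => b < a := wellFounded_gt
  let F : ∀ w : W, (∀ x, w < x → ℝ) → ℝ := fun w V => g w +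
    ∑ j with D.par j = w, (D.kids j).sup' (D.kids_nonempty j)
      fun x => if h : w < x then V x h else 0
  refine ⟨wf.fix F, fun w => ?_⟩
  rw [wf.fix_eq]
  refine congrArg _ (Finset.sum_congr rfl fun j hj => Finset.sup'_congr _ rfl fun x hx => ?_)
  exact dif_pos ((Finset.mem_filter.1 hj).2 ▸ D.par_lt hx)

variable (D) in
theorem exists_isLoss_sub [Finite J] {V : W → ℝ} {M : J → ℝ}
    (hVM : ∀ j, ∀ w ∈ D.kids j, V w ≤ M j) (hM : ∀ j, ∃ w ∈ D.kids j, V w = M j) :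
    ∃ L, D.IsLoss L ∧ ∀ j, ∀ w ∈ D.kids j, L w = M j - V w := by
  classical
  cases nonempty_fintype J
  set L : W → ℝ := fun w => ∑ j with w ∈ D.kids j, (M j - V w)
  have hL : ∀ j, ∀ w ∈ D.kids j, L w = M j - V w := fun j w hw => by
    have : Finset.univ.filter (fun k => w ∈ D.kids k) = {j} := by
      ext k
      simpa using ⟨fun hk => D.kids_unique _ _ _ hk hw, fun hk => hk ▸ hw⟩
    simp only [L, this, Finset.sum_singleton]
  refine ⟨L, ⟨fun w => Finset.sum_nonneg fun j hj => ?_, ?_, fun j => ?_⟩, hL⟩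
  · exact sub_nonneg.2 (hVM j w (Finset.mem_filter.1 hj).2)
  · exact Finset.sum_eq_zero fun j hj =>
      absurd (Finset.mem_filter.1 hj).2 (D.root_notMem_kids j)
  · obtain ⟨w, hw, hwM⟩ := hM j
    exact ⟨w, hw, by rw [hL j w hw, hwM, sub_self]⟩

variable (D) in
/-- Backward induction. -/
theorem exists_isLoss_sum_mul_eq [Fintype W] [Finite J] (g : W → ℝ) :
    ∃ (V : ℝ) (L : W → ℝ), D.IsLoss L ∧
      ∀ ρ ∈ D.flows, ∑ w, ρ w * g w = V * ρ D.root - ∑ w, ρ w * L w := by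
  classical
  cases nonempty_fintype J
  obtain ⟨V, hV⟩ := D.exists_value g
  set M : J → ℝ := fun j => (D.kids j).sup' (D.kids_nonempty j) V
  obtain ⟨L, hL, hLM⟩ := D.exists_isLoss_sub (M := M) (fun j w hw => Finset.le_sup' V hw)
    fun j => (Finset.exists_mem_eq_sup' (D.kids_nonempty j) V).imp fun w hw => ⟨hw.1, hw.2.symm⟩
  refine ⟨V D.root, L, hL, fun ρ hρ => ?_⟩
  have hg : ∑ w, ρ w * g w = ∑ w, ρ w * V w - ∑ j, ∑ w ∈ D.kids j, ρ w * M j := by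
    simp only [← Finset.sum_mul, show ∀ j, ∑ w ∈ D.kids j, ρ w = ρ (D.par j) from hρ]
    rw [← Finset.sum_fiberwise Finset.univ D.par, ← Finset.sum_sub_distrib]
    refine Finset.sum_congr rfl fun w _ => ?_
    rw [hV w, mul_add, Finset.mul_sum, eq_sub_iff_add_eq]
    refine congrArg _ (Finset.sum_congr rfl fun j hj => ?_)
    rw [(Finset.mem_filter.1 hj).2]
  have hkids : ∑ j, ∑ w ∈ D.kids j, ρ w * L w =
      ∑ j, ∑ w ∈ D.kids j, ρ w * M j - ∑ j, ∑ w ∈ D.kids j, ρ w * V w := by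
    simp only [← Finset.sum_sub_distrib, ← mul_sub]
    exact Finset.sum_congr rfl fun j _ => Finset.sum_congr rfl fun w hw => by rw [hLM j w hw]
  rw [hg, D.sum_eq_root_add_sum_kids, D.sum_eq_root_add_sum_kids fun w => ρ w * L w, hL.root,
    hkids]
  ring

/-! ### Pure strategies -/

variable (D) in
/-- `S` is the set of the sequences played by a pure strategy of the reduced normal form. -/
structure IsPureStrategy (S : Finset W) : Prop where
  root_mem : D.root ∈ S
  existsUnique_kid : ∀ j, D.par j ∈ S → ∃! w, w ∈ D.kids j ∧ w ∈ S
  par_mem : ∀ j, ∀ w ∈ D.kids j, w ∈ S → D.par j ∈ S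

theorem IsPureStrategy.mem_of_le [Finite W] {S : Finset W} (hS : D.IsPureStrategy S) {x w : W}
    (hxw : x ≤ w) (hw : w ∈ S) : x ∈ S := by
  induction w using D.induction with
  | root => rwa [le_antisymm hxw (D.root_le x)]
  | kid k w hwk ih =>
    rcases (D.le_iff k w hwk x).1 hxw with rfl | hxk
    · exact hw
    · exact ih hxk (hS.par_mem k w hwk hw)

theorem IsPureStrategy.indicator_mem_flows {S : Finset W} (hS : D.IsPureStrategy S) :
    (S : Set W).indicator 1 ∈ D.flows := fun j => by
  classical
  simp only [Set.indicator_apply, Finset.mem_coe, Pi.one_apply]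
  by_cases h : D.par j ∈ S
  · obtain ⟨w, ⟨hw, hwS⟩, huniq⟩ := hS.existsUnique_kid j h
    rw [if_pos h, Finset.sum_eq_single_of_mem w hw, if_pos hwS]
    exact fun x hx hxw => if_neg fun hxS => hxw (huniq x ⟨hx, hxS⟩)
  · rw [if_neg h]
    exact Finset.sum_eq_zero fun w hw => if_neg fun hwS => h (hS.par_mem j w hw hwS)

open Classical in
variable (D) in
/-- The sequences played when the action leading to `f j` is chosen at each information set `j`. -/
noncomputable def follow [Fintype W] (f : J → W) : Finset W :=
  {w | ∀ j, ∀ x ∈ D.kids j, x ≤ w → x = f j}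

theorem mem_follow [Fintype W] {f : J → W} {w : W} :
    w ∈ D.follow f ↔ ∀ j, ∀ x ∈ D.kids j, x ≤ w → x = f j := by
  simp [follow]

theorem isPureStrategy_follow [Fintype W] {f : J → W} (hf : ∀ j, f j ∈ D.kids j) :
    D.IsPureStrategy (D.follow f) where
  root_mem := mem_follow.2 fun j x hx hle =>
    absurd (le_antisymm hle (D.root_le x) ▸ hx) (D.root_notMem_kids j)
  existsUnique_kid j hj := by
    refine ⟨f j, ⟨hf j, mem_follow.2 fun k x hx hle => ?_⟩,
      fun y hy => mem_follow.1 hy.2 j y hy.1 le_rfl⟩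
    rcases (D.le_iff j _ (hf j) x).1 hle with rfl | hle
    · rw [D.kids_unique _ _ _ hx (hf j)]
    · exact mem_follow.1 hj k x hx hle
  par_mem j w hw hwS := mem_follow.2 fun k x hx hle =>
    mem_follow.1 hwS k x hx (hle.trans (D.par_lt hw).le)

variable (D) in
theorem exists_isPureStrategy [Finite W] (w₀ : W) (R : W → Prop) (hw₀ : ∀ x ≤ w₀, R x)
    (hR : ∀ j, R (D.par j) → (∀ w ∈ D.kids j, ¬ w ≤ w₀) → ∃ w ∈ D.kids j, R w) :
    ∃ S, D.IsPureStrategy S ∧ w₀ ∈ S ∧ ∀ x ∈ S, R x := by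
  cases nonempty_fintype W
  have hchoice : ∀ j, ∃ w ∈ D.kids j,
      (R (D.par j) → R w) ∧ ∀ x ∈ D.kids j, x ≤ w₀ → x = w := by
    intro j
    by_cases hon : ∃ w ∈ D.kids j, w ≤ w₀
    · obtain ⟨w, hw, hle⟩ := hon
      exact ⟨w, hw, fun _ => hw₀ w hle, fun x hx hx' => D.eq_of_mem_kids_of_le hx hw hx' hle⟩
    push Not at hon
    by_cases hpar : R (D.par j)
    · obtain ⟨w, hw, hRw⟩ := hR j hpar hon
      exact ⟨w, hw, fun _ => hRw, fun x hx hx' => absurd hx' (hon x hx)⟩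
    · obtain ⟨w, hw⟩ := D.kids_nonempty j
      exact ⟨w, hw, fun h => absurd h hpar, fun x hx hx' => absurd hx' (hon x hx)⟩
  choose f hf hfR hfu using hchoice
  have hS := isPureStrategy_follow hf
  refine ⟨D.follow f, hS, mem_follow.2 hfu, fun x => ?_⟩
  induction x using D.induction with
  | root => exact fun _ => hw₀ _ (D.root_le _)
  | kid j w hw ih =>
    intro hwS
    rw [mem_follow.1 hwS j w hw le_rfl]
    exact hfR j (ih (hS.par_mem j w hw hwS))

/-! ### The loss along a sequence -/

section PathLoss

variable [Fintype W] {L : W → ℝ}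

open Classical in
/-- The total loss along the sequence `w`. It is the least loss of a strategy that plays `w`. -/
noncomputable def pathLoss (L : W → ℝ) (w : W) : ℝ := ∑ x with x ≤ w, L x

theorem IsLoss.pathLoss_root (hL : D.IsLoss L) : pathLoss L D.root = 0 := by
  classical
  refine Finset.sum_eq_zero fun x hx => ?_
  rw [le_antisymm (Finset.mem_filter.1 hx).2 (D.root_le x), hL.root]

theorem pathLoss_of_mem_kids {j : J} {w : W} (hw : w ∈ D.kids j) :
    pathLoss L w = L w + pathLoss L (D.par j) := by
  classical
  unfold pathLoss
  rw [← Finset.sum_insert (by simp [D.not_le j w hw])]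
  refine Finset.sum_congr ?_ fun _ _ => rfl
  ext x
  simp [D.le_iff j w hw x]

theorem IsLoss.le_pathLoss (hL : D.IsLoss L) (w : W) : L w ≤ pathLoss L w := by
  classical
  exact Finset.single_le_sum (f := L) (fun x _ => hL.nonneg x) (by simp)

theorem IsLoss.pathLoss_le_sum_mul (hL : D.IsLoss L) {ρ : W → ℝ} (hρ : ρ ∈ D.flows)
    (h0 : 0 ≤ ρ) {w : W} (hw : ρ w = 1) : pathLoss L w ≤ ∑ x, ρ x * L x := by
  classical
  calc pathLoss L w ≤ ∑ x with x ≤ w, ρ x * L x := Finset.sum_le_sum fun x hx =>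
        le_mul_of_one_le_left (hL.nonneg x)
          (hw ▸ le_of_mem_flows_of_le hρ h0 (Finset.mem_filter.1 hx).2)
    _ ≤ ∑ x, ρ x * L x := Finset.sum_le_univ_sum_of_nonneg fun x => mul_nonneg (h0 x) (hL.nonneg x)

theorem IsPureStrategy.pathLoss_le_sum {S : Finset W} (hS : D.IsPureStrategy S)
    (hL : D.IsLoss L) {w : W} (hw : w ∈ S) : pathLoss L w ≤ ∑ x ∈ S, L x := by
  classical
  exact Finset.sum_le_sum_of_subset_of_nonneg
    (fun _ hx => hS.mem_of_le (Finset.mem_filter.1 hx).2 hw) fun x _ _ => hL.nonneg x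

theorem IsPureStrategy.sum_eq_pathLoss {S : Finset W} (hS : D.IsPureStrategy S) {w : W}
    (hw : w ∈ S) (h : ∀ x ∈ S, L x = 0 ∨ x ≤ w) : ∑ x ∈ S, L x = pathLoss L w := by
  classical
  exact (Finset.sum_subset (fun _ hx => hS.mem_of_le (Finset.mem_filter.1 hx).2 hw)
    fun x hx hxw => (h x hx).resolve_right fun hle => hxw (by simpa using hle)).symm

theorem IsLoss.exists_isPureStrategy_sum_eq (hL : D.IsLoss L) (w : W) :
    ∃ S, D.IsPureStrategy S ∧ w ∈ S ∧ ∑ x ∈ S, L x = pathLoss L w := by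
  obtain ⟨S, hS, hw, h⟩ := D.exists_isPureStrategy w (fun x => L x = 0 ∨ x ≤ w)
    (fun x hx => Or.inr hx) fun j _ _ => (hL.exists_zero j).imp fun x hx => ⟨hx.1, Or.inl hx.2⟩
  exact ⟨S, hS, hw, hS.sum_eq_pathLoss hw h⟩

/-- The strategy `S` has no loss off one of its sequences. -/
def IsTight (L : W → ℝ) (S : Finset W) : Prop := ∃ w ∈ S, ∑ x ∈ S, L x = pathLoss L w

/-- A function `ρ` is steep if it decreases so fast with the loss that its value at `x` dominates
the total of its values at the sequences of larger loss. In contrast to `IsEpsProper`, this is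
inherited by the remainder when a suitable strategy is subtracted from a flow. -/
def IsSteep (L ρ : W → ℝ) : Prop := ∀ x, ∑ w with pathLoss L x < pathLoss L w, ρ w ≤ ρ x

variable {ρ : W → ℝ} {w₀ : W}

/-- Otherwise every sequence through `j` played with positive weight has larger loss than `par j`,
and so has `w₀`: these already exceed the weight of `par j`. -/
theorem IsSteep.exists_mem_kids (hs : IsSteep L ρ) (hL : D.IsLoss L) (hρ : ρ ∈ D.flows)
    (h0 : 0 ≤ ρ) (hw₀ : 0 < ρ w₀) (hmax : ∀ w, 0 < ρ w → pathLoss L w ≤ pathLoss L w₀) {j : J}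
    (hj : 0 < ρ (D.par j)) (hoff : w₀ ∉ D.kids j) : ∃ w ∈ D.kids j, 0 < ρ w ∧ L w = 0 := by
  classical
  by_contra! hcon
  have hlt : ∀ w ∈ D.kids j, 0 < ρ w → pathLoss L (D.par j) < pathLoss L w := fun w hw hpos => by
    rw [pathLoss_of_mem_kids hw]
    exact lt_add_of_pos_left _ ((hL.nonneg w).lt_of_ne' (hcon w hw hpos))
  obtain ⟨w₁, hw₁, hpos₁⟩ : ∃ w ∈ D.kids j, 0 < ρ w :=
    Finset.exists_lt_of_sum_lt (by simpa [show ∑ w ∈ D.kids j, ρ w = _ from hρ j] using hj)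
  have hlt₀ : pathLoss L (D.par j) < pathLoss L w₀ :=
    (hlt w₁ hw₁ hpos₁).trans_le (hmax w₁ hpos₁)
  have hle : ρ w₀ + ρ (D.par j) ≤ ρ (D.par j) := by
    calc ρ w₀ + ρ (D.par j) = ρ w₀ + ∑ w ∈ D.kids j with 0 < ρ w, ρ w := by
          rw [← hρ j, Finset.sum_filter_of_ne (p := fun w => 0 < ρ w)
            fun w _ hw => (h0 w).lt_of_ne' hw]
      _ = ∑ w ∈ insert w₀ {w ∈ D.kids j | 0 < ρ w}, ρ w := by
          rw [Finset.sum_insert (by simp [hoff])]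
      _ ≤ ∑ w with pathLoss L (D.par j) < pathLoss L w, ρ w := by
          refine Finset.sum_le_sum_of_subset_of_nonneg (fun w hw => ?_) fun w _ _ => h0 w
          rcases Finset.mem_insert.1 hw with rfl | hw
          · simpa using hlt₀
          · simpa using hlt w (Finset.mem_filter.1 hw).1 (Finset.mem_filter.1 hw).2
      _ ≤ ρ (D.par j) := hs _
  linarith

theorem IsSteep.sub_smul_indicator (hs : IsSteep L ρ) {S : Finset W} {m : ℝ} (hm : 0 ≤ m)
    (hle : 0 ≤ ρ - m • (S : Set W).indicator 1) (hw₀ : w₀ ∈ S)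
    (hmax : ∀ w, 0 < ρ w → pathLoss L w ≤ pathLoss L w₀) :
    IsSteep L (ρ - m • (S : Set W).indicator 1) := by
  set δ : W → ℝ := m • (S : Set W).indicator 1
  have hδ0 : ∀ w, 0 ≤ δ w := fun w =>
    mul_nonneg hm (Set.indicator_nonneg (fun _ _ => zero_le_one) w)
  have hδm : ∀ w, δ w ≤ m := fun w =>
    mul_le_of_le_one_right hm (Set.indicator_le_self' (fun _ _ => zero_le_one) w)
  intro x
  by_cases hx : pathLoss L x < pathLoss L w₀
  · have hm_le : m ≤ ∑ w with pathLoss L x < pathLoss L w, δ w := by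
      calc m = δ w₀ := by simp [δ, hw₀]
        _ ≤ _ := Finset.single_le_sum (fun w _ => hδ0 w) (by simpa using hx)
    calc ∑ w with pathLoss L x < pathLoss L w, (ρ - δ) w
        = ∑ w with pathLoss L x < pathLoss L w, ρ w -
          ∑ w with pathLoss L x < pathLoss L w, δ w := Finset.sum_sub_distrib _ _
      _ ≤ ρ x - δ x := sub_le_sub (hs x) ((hδm x).trans hm_le)
  · refine (Finset.sum_nonpos fun w hw => ?_).trans (hle x)
    have hρw : ρ w ≤ 0 := not_lt.1 fun hpos =>
      hx ((Finset.mem_filter.1 hw).2.trans_le (hmax w hpos))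
    exact sub_nonpos.2 (hρw.trans (hδ0 w))

theorem IsSteep.exists_isTight (hs : IsSteep L ρ) (hL : D.IsLoss L) (hρ : ρ ∈ D.flows)
    (h0 : 0 ≤ ρ) (hroot : 0 < ρ D.root) :
    ∃ S, D.IsPureStrategy S ∧ IsTight L S ∧ (∀ x ∈ S, 0 < ρ x) ∧
      ∃ w₀ ∈ S, ∀ w, 0 < ρ w → pathLoss L w ≤ pathLoss L w₀ := by
  obtain ⟨w₀, hw₀, hmax⟩ :=
    Set.exists_max_image {w | 0 < ρ w} (pathLoss L) (Set.toFinite _) ⟨D.root, hroot⟩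
  obtain ⟨S, hS, hw₀S, hR⟩ := D.exists_isPureStrategy w₀ (fun x => 0 < ρ x ∧ (L x = 0 ∨ x ≤ w₀))
    (fun x hx => ⟨lt_of_lt_of_le hw₀ (le_of_mem_flows_of_le hρ h0 hx), Or.inr hx⟩)
    fun j hj hoff => (hs.exists_mem_kids hL hρ h0 hw₀ hmax hj.1 fun h => hoff _ h le_rfl).imp
      fun w hw => ⟨hw.1, hw.2.1, Or.inl hw.2.2⟩
  exact ⟨S, hS, ⟨w₀, hw₀S, hS.sum_eq_pathLoss hw₀S fun x hx => (hR x hx).2⟩,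
    fun x hx => (hR x hx).1, w₀, hw₀S, hmax⟩

theorem IsSteep.exists_peel (hs : IsSteep L ρ) (hL : D.IsLoss L) (hρ : ρ ∈ D.flows)
    (h0 : 0 ≤ ρ) (hroot : 0 < ρ D.root) :
    ∃ (S : Finset W) (m : ℝ), D.IsPureStrategy S ∧ IsTight L S ∧ 0 ≤ m ∧
      0 ≤ ρ - m • (S : Set W).indicator 1 ∧ IsSteep L (ρ - m • (S : Set W).indicator 1) ∧
      Function.support (ρ - m • (S : Set W).indicator 1) ⊂ Function.support ρ := by
  obtain ⟨S, hS, htight, hpos, w₀, hw₀, hmax⟩ := hs.exists_isTight hL hρ h0 hroot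
  obtain ⟨x, hx, hmin⟩ := S.exists_min_image ρ ⟨w₀, hw₀⟩
  have hle : 0 ≤ ρ - ρ x • (S : Set W).indicator 1 := fun w => by
    by_cases hw : w ∈ S
    · simpa [hw] using hmin w hw
    · simpa [hw] using h0 w
  refine ⟨S, ρ x, hS, htight, h0 x, hle, hs.sub_smul_indicator (h0 x) hle hw₀ hmax,
    (Set.ssubset_iff_of_subset (Function.support_subset_iff'.2 fun w hw => ?_)).2
      ⟨x, (hpos x hx).ne', by simp [hx]⟩⟩
  have hρw : ρ w = 0 := Function.notMem_support.1 hw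
  have hwS : w ∉ S := fun hwS => (hpos w hwS).ne' hρw
  simp [hwS, hρw]

end PathLoss

/-! ### Decomposition of flows -/

section Mixture

variable {P : Type*} [Fintype P] {act : P → Finset W}

theorem realization_mem_flows (hact : ∀ p, D.IsPureStrategy (act p)) (τ : P → ℝ) :
    realization act τ ∈ D.flows := by
  rw [realization, Fintype.linearCombination_apply]
  exact Submodule.sum_mem _ fun p _ => Submodule.smul_mem _ _ (hact p).indicator_mem_flows

theorem realization_root (hact : ∀ p, D.IsPureStrategy (act p)) (τ : P → ℝ) :
    realization act τ D.root = ∑ p, τ p := by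
  classical
  rw [realization_apply, Finset.filter_true_of_mem fun p _ => (hact p).root_mem]

variable [Fintype W] {L : W → ℝ}

theorem IsSteep.exists_realization_eq (hL : D.IsLoss L)
    (hsurj : ∀ S, D.IsPureStrategy S → ∃ p, act p = S) {ρ : W → ℝ} (hs : IsSteep L ρ)
    (hρ : ρ ∈ D.flows) (h0 : 0 ≤ ρ) :
    ∃ d : P → ℝ, 0 ≤ d ∧ realization act d = ρ ∧ ∀ p, d p ≠ 0 → IsTight L (act p) := by
  classical
  induction hn : Function.support ρ using WellFoundedLT.induction generalizing ρ with
  | ind s ih =>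
    rcases (h0 D.root).eq_or_lt' with hroot | hroot
    · refine ⟨0, le_rfl, funext fun w => ?_, fun p hp => absurd rfl hp⟩
      rw [map_zero]
      exact le_antisymm (h0 w) ((le_of_mem_flows_of_le hρ h0 (D.root_le w)).trans_eq hroot)
    obtain ⟨S, m, hS, htight, hm, h0', hs', hsupp⟩ := hs.exists_peel hL hρ h0 hroot
    obtain ⟨p, rfl⟩ := hsurj S hS
    obtain ⟨d, hd0, hd, hdt⟩ := ih _ (hn ▸ hsupp) hs'
      (Submodule.sub_mem _ hρ (Submodule.smul_mem _ _ hS.indicator_mem_flows)) h0' rfl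
    refine ⟨d + Pi.single p m, add_nonneg hd0 (Pi.single_nonneg.2 hm), ?_, fun q hq => ?_⟩
    · rw [map_add, hd, realization_single, sub_add_cancel]
    · rcases eq_or_ne q p with rfl | hqp
      · exact htight
      · exact hdt q (by simpa [hqp] using hq)

/-! ### Proper mixed strategies and proper realization plans -/

theorem isEpsProper_realization (hL : D.IsLoss L) (hact : ∀ p, D.IsPureStrategy (act p))
    (hsurj : ∀ S, D.IsPureStrategy S → ∃ p, act p = S) {τ : P → ℝ} (hτ : 0 ≤ τ) {ε : ℝ}
    (hε : 0 ≤ ε) (h : IsEpsProper ε (fun p => ∑ x ∈ act p, L x) τ) :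
    IsEpsProper (Fintype.card P * ε) (pathLoss L) (realization act τ) := by
  intro x y hxy
  obtain ⟨_, hS, hx, hsum⟩ := hL.exists_isPureStrategy_sum_eq x
  obtain ⟨p, rfl⟩ := hsurj _ hS
  rw [mul_assoc]
  refine realization_le (mul_nonneg hε (realization_nonneg hτ x)) fun q hq => ?_
  calc τ q ≤ ε * τ p := h <| hsum.trans_lt (hxy.trans_le ((hact q).pathLoss_le_sum hL hq))
    _ ≤ ε * realization act τ x := mul_le_mul_of_nonneg_left (le_realization hτ hx) hε

variable {γ : W → ℝ} {κ : ℝ}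

theorem isSteep_of_isEpsProper (h : IsEpsProper κ (pathLoss L) γ) (hκ : 0 ≤ κ) (h0 : 0 ≤ γ)
    {ρ : W → ℝ} (hργ : ρ ≤ γ) (hγρ : (Fintype.card W * κ) • γ ≤ ρ) : IsSteep L ρ := by
  intro x
  calc ∑ w with pathLoss L x < pathLoss L w, ρ w
      ≤ (Finset.univ.filter fun w => pathLoss L x < pathLoss L w).card • (κ * γ x) :=
        Finset.sum_le_card_nsmul _ _ _ fun w hw =>
          (hργ w).trans (h (Finset.mem_filter.1 hw).2)
    _ ≤ Fintype.card W • (κ * γ x) :=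
        nsmul_le_nsmul_left (mul_nonneg hκ (h0 x)) (Finset.card_le_univ _)
    _ = (Fintype.card W * κ) • γ x := by rw [nsmul_eq_mul, smul_eq_mul, mul_assoc]
    _ ≤ ρ x := hγρ x

theorem sum_eq_zero_of_isEpsProper (hL : D.IsLoss L) (h : IsEpsProper κ (pathLoss L) γ)
    {S : Finset W} (hS : ∀ x ∈ S, κ * γ D.root < γ x) : ∑ x ∈ S, L x = 0 :=
  Finset.sum_eq_zero fun x hx => le_antisymm
    (not_lt.1 fun hLx => (h <| hL.pathLoss_root.trans_lt (hLx.trans_le (hL.le_pathLoss x))).not_gt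
      (hS x hx)) (hL.nonneg x)

/-- What remains of `γ` when the mixed strategies `σ` and `c` are subtracted from it is again
a mixture, namely one of tight strategies. -/
theorem exists_realization_add_eq (hL : D.IsLoss L) (hact : ∀ p, D.IsPureStrategy (act p))
    (hsurj : ∀ S, D.IsPureStrategy S → ∃ p, act p = S) (hγ : γ ∈ D.flows) (h0 : 0 ≤ γ)
    (hκ : 0 ≤ κ) (h : IsEpsProper κ (pathLoss L) γ) {σ c : P → ℝ} (hσ : 0 ≤ σ) (hc : 0 ≤ c)
    (hle : realization act (σ + c) ≤ (1 - Fintype.card W * κ) • γ) :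
    ∃ d : P → ℝ, 0 ≤ d ∧ realization act (σ + c + d) = γ ∧ ∀ p, d p ≠ 0 → IsTight L (act p) := by
  set ρ : W → ℝ := γ - realization act (σ + c)
  have hργ : ρ ≤ γ := sub_le_self _ (realization_nonneg (add_nonneg hσ hc))
  have hγρ : (Fintype.card W * κ) • γ ≤ ρ := by
    rw [le_sub_comm]
    simpa only [sub_smul, one_smul] using hle
  have hρ0 : 0 ≤ ρ := (smul_nonneg (by positivity) h0).trans hγρ
  obtain ⟨d, hd0, hd, htight⟩ := (isSteep_of_isEpsProper h hκ h0 hργ hγρ).exists_realization_eq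
    hL hsurj (Submodule.sub_mem _ hγ (realization_mem_flows hact _)) hρ0
  exact ⟨d, hd0, by rw [map_add, hd, add_sub_cancel], htight⟩

/-- `σ` puts weight only on optimal strategies, `c` is positive and proper, and `d` takes up the
remaining weight of `γ`; `c` is so small that it does not affect the feasibility of `d`, and so
large that it dominates `d` wherever properness requires it. -/
theorem exists_isEpsProper_realization_eq (hL : D.IsLoss L)
    (hact : ∀ p, D.IsPureStrategy (act p)) (hsurj : ∀ S, D.IsPureStrategy S → ∃ p, act p = S)
    (hγ : γ ∈ D.flows) (hpos : ∀ w, 0 < γ w) (hκ : 0 < κ) (hκ1 : κ ≤ 1)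
    (h : IsEpsProper (κ ^ (Fintype.card P + 1)) (pathLoss L) γ) {σ : P → ℝ} (hσ : 0 ≤ σ)
    (hσL : ∀ p, σ p ≠ 0 → ∑ x ∈ act p, L x = 0)
    (hle : realization act σ ≤ (1 - Fintype.card W * κ - Fintype.card P * κ) • γ) :
    ∃ τ : P → ℝ, (∀ p, 0 < τ p) ∧ realization act τ = γ ∧ σ ≤ τ ∧
      IsEpsProper (2 * κ) (fun p => ∑ x ∈ act p, L x) τ := by
  have h0 : 0 ≤ γ := fun w => (hpos w).le
  obtain ⟨c, hc0, hc, hcγ, hγc⟩ := h.exists_interpolation hκ hκ1 hpos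
    (a := fun p => ∑ x ∈ act p, L x) (b := pathLoss L)
    fun p => ⟨D.root, (hact p).pathLoss_le_sum hL (hact p).root_mem⟩
  have hcle : realization act c ≤ (Fintype.card P * κ) • γ := fun w => by
    rw [Pi.smul_apply, smul_eq_mul, mul_assoc]
    exact realization_le (mul_pos hκ (hpos w)).le
      fun p hp => hcγ p w ((hact p).pathLoss_le_sum hL hp)
  have hσc : realization act (σ + c) ≤ (1 - Fintype.card W * κ) • γ := by
    rw [map_add, ← sub_add_cancel (1 - Fintype.card W * κ) (Fintype.card P * κ), add_smul]
    exact add_le_add hle hcle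
  have hκγ : IsEpsProper κ (pathLoss L) γ :=
    h.mono (pow_le_of_le_one hκ.le hκ1 (Nat.succ_ne_zero _)) h0
  obtain ⟨d, hd0, hd, htight⟩ := exists_realization_add_eq hL hact hsurj hγ h0 hκ.le hκγ hσ
    (fun p => (hc0 p).le) hσc
  have hdc : ∀ p q, ∑ x ∈ act p, L x < ∑ x ∈ act q, L x → d q ≤ κ * c p := fun p q hpq => by
    by_cases hq : d q = 0
    · exact hq ▸ (mul_pos hκ (hc0 p)).le
    obtain ⟨w, hw, hsum⟩ := htight q hq
    calc d q ≤ realization act d w := le_realization hd0 hw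
      _ ≤ realization act (σ + c + d) w := by
          rw [map_add]
          exact le_add_of_nonneg_left (realization_nonneg (add_nonneg hσ fun p => (hc0 p).le) w)
      _ = γ w := congrFun hd w
      _ ≤ κ * c p := hγc p w (hsum ▸ hpq)
  have hcτ : ∀ p, c p ≤ σ p + c p + d p := fun p =>
    (le_add_of_nonneg_left (hσ p)).trans (le_add_of_nonneg_right (hd0 p))
  refine ⟨σ + c + d, fun p => (hc0 p).trans_le (hcτ p), hd, fun p => ?_, fun p q hpq => ?_⟩
  · exact le_add_of_le_of_nonneg (le_add_of_nonneg_right (hc0 p).le) (hd0 p)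
  · have hσq : σ q = 0 := by
      by_contra hq
      exact hpq.not_ge ((hσL q hq).trans_le (Finset.sum_nonneg fun x _ => hL.nonneg x))
    calc σ q + c q + d q ≤ 2 * (κ * c p) := by linarith [hc hpq, hdc p q hpq]
      _ ≤ 2 * κ * (σ p + c p + d p) := by
          rw [mul_assoc]
          gcongr
          exact hcτ p

/-- The mixed strategy near `σ` that realizes `γ` extends `θ • σ` for some `θ` close to `1`. As
`η • realization act σ ≤ γ` for `η > θ` and `γ` close to the realization plan of `σ`, this leaves
a fixed share of `γ` to the other strategies. -/
theorem exists_forall_isEpsProper_realization_eq (hact : ∀ p, D.IsPureStrategy (act p))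
    (hsurj : ∀ S, D.IsPureStrategy S → ∃ p, act p = S) {σ : P → ℝ} (hσ : σ ∈ stdSimplex ℝ P)
    {U : Set (P → ℝ)} (hU : U ∈ 𝓝 σ) {ε : ℝ} (hε : 0 < ε) :
    ∃ δ > 0, ∀ᶠ γ in 𝓝 (realization act σ), ∀ L, D.IsLoss L → γ ∈ D.flows → γ D.root = 1 →
      (∀ w, 0 < γ w) → IsEpsProper δ (pathLoss L) γ → ∃ τ ∈ U, (∀ p, 0 < τ p) ∧
        realization act τ = γ ∧ IsEpsProper ε (fun p => ∑ x ∈ act p, L x) τ := by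
  obtain ⟨θ, hθU, hθ0, hθ1⟩ := ((eventually_forall_smul_le_mem_of_mem_nhds hσ hU).and
    (eventually_mem_set.2 (Ioo_mem_nhdsLT zero_lt_one))).exists
  obtain ⟨η, hθη, hη1⟩ := exists_between hθ1
  have hη0 : 0 < η := hθ0.trans hθη
  have hκσ : ∀ p, ∀ᶠ κ in 𝓝[>] (0 : ℝ), 0 < σ p → 1 * κ < η * σ p := fun p => by
    simpa only [eventually_imp_distrib_left] using
      fun hp => eventually_mul_lt_nhdsGT_zero 1 (mul_pos hη0 hp)
  obtain ⟨κ, hκ0, hκ1, hκε, hκθ, hκσ⟩ := (eventually_mem_nhdsWithin.and <|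
    (eventually_mul_lt_nhdsGT_zero 1 one_pos).and <| (eventually_mul_lt_nhdsGT_zero 2 hε).and <|
    (eventually_mul_lt_nhdsGT_zero (Fintype.card W + Fintype.card P)
      (sub_pos.2 ((div_lt_one hη0).2 hθη))).and (eventually_all.2 hκσ)).exists
  rw [one_mul] at hκ1
  have hσ0 : 0 ≤ realization act σ := realization_nonneg hσ.1
  refine ⟨κ ^ (Fintype.card P + 1), pow_pos hκ0 _, ?_⟩
  filter_upwards [eventually_smul_le_of_lt_one hσ0 hη1] with γ hηγ L hL hγ hroot hpos h
  have h0 : 0 ≤ γ := fun w => (hpos w).le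
  have hσL : ∀ p, (θ • σ) p ≠ 0 → ∑ x ∈ act p, L x = 0 := fun p hp => by
    have hσp : 0 < σ p := (hσ.1 p).lt_of_ne' (right_ne_zero_of_mul hp)
    refine sum_eq_zero_of_isEpsProper hL
      (h.mono (pow_le_of_le_one hκ0.le hκ1.le (Nat.succ_ne_zero _)) h0) fun x hx => ?_
    calc κ * γ D.root = 1 * κ := by rw [hroot, mul_comm]
      _ < η * σ p := hκσ p hσp
      _ ≤ η * realization act σ x := mul_le_mul_of_nonneg_left (le_realization hσ.1 hx) hη0.le
      _ ≤ γ x := hηγ h0 x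
  have hle : realization act (θ • σ) ≤ (1 - Fintype.card W * κ - Fintype.card P * κ) • γ := by
    calc realization act (θ • σ) = (θ / η) • η • realization act σ := by
          rw [map_smul, smul_smul, div_mul_cancel₀ _ hη0.ne']
      _ ≤ (θ / η) • γ := smul_le_smul_of_nonneg_left (hηγ h0) (div_pos hθ0 hη0).le
      _ ≤ _ := smul_le_smul_of_nonneg_right (by linarith) h0
  obtain ⟨τ, hτ0, hτγ, hθτ, hτ⟩ := exists_isEpsProper_realization_eq hL hact hsurj hγ hpos hκ0
    hκ1.le h (smul_nonneg hθ0.le hσ.1) hσL hle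
  have hτ1 : ∑ p, τ p = 1 := by rw [← realization_root hact, hτγ, hroot]
  exact ⟨τ, hθU τ ⟨fun p => (hτ0 p).le, hτ1⟩ hθτ, hτ0, hτγ, hτ.mono hκε.le fun p => (hτ0 p).le⟩

end Mixture

end DecisionTree

namespace ExtensiveGame

variable {N α : Type*} [DecidableEq N] [DecidableEq α] {G : ExtensiveGame N α}

section Histories

theorem mem_nodes {j : Option N} {h : List α} :
    h ∈ G.nodes j ↔ h ∈ G.H ∧ (G.actions h).Nonempty ∧ G.mover h = j := by
  simp [nodes]

theorem mem_nodes_of_cons_mem {a : α} {h : List α} (hh : a :: h ∈ G.H) :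
    h ∈ G.nodes (G.mover h) :=
  mem_nodes.2 ⟨G.tail_mem a h hh, ⟨a, G.mem_actions.2 hh⟩, rfl⟩

theorem mem_cell_self {j : Option N} {h : List α} (hh : h ∈ G.nodes j) : h ∈ G.cell j h :=
  match j with
  | none => Finset.mem_singleton_self h
  | some i => (G.info i).mem_part_self.2 hh

theorem seqSet_nil (j : Option N) : G.seqSet j [] = ∅ := rfl

theorem seqSet_cons_of_mem_nodes {j : Option N} {h : List α} (hh : h ∈ G.nodes j) (a : α) :
    G.seqSet j (a :: h) = insert (G.cell j h, a) (G.seqSet j h) := by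
  simp [seqSet, record, (mem_nodes.1 hh).2.2]

theorem seqSet_cons_of_ne {j : Option N} {h : List α} (hj : G.mover h ≠ j) (a : α) :
    G.seqSet j (a :: h) = G.seqSet j h := by
  simp [seqSet, record, hj]

theorem cell_mem_seqSet_cons {j : Option N} {h : List α} (hh : h ∈ G.nodes j) (a : α) :
    (G.cell j h, a) ∈ G.seqSet j (a :: h) :=
  seqSet_cons_of_mem_nodes hh a ▸ Finset.mem_insert_self _ _

theorem record_suffix (j : Option N) {h' h : List α} (hs : h' <:+ h) :
    G.record j h' <:+ G.record j h := by
  induction h with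
  | nil => rw [List.suffix_nil.1 hs]
  | cons a h ih =>
    rcases List.suffix_cons_iff.1 hs with rfl | hs
    · exact List.suffix_rfl
    · refine (ih hs).trans ?_
      rw [record]
      split_ifs
      · exact List.suffix_cons _ _
      · exact List.suffix_rfl

theorem seqSet_subset_of_suffix (j : Option N) {h' h : List α} (hs : h' <:+ h) :
    G.seqSet j h' ⊆ G.seqSet j h := fun _ hm =>
  List.mem_toFinset.2 ((record_suffix j hs).subset (List.mem_toFinset.1 hm))

theorem exists_mem_nodes_of_mem_seqSet {j : Option N} {h : List α} {I : Finset (List α)} {a : α}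
    (hh : h ∈ G.H) (hm : (I, a) ∈ G.seqSet j h) :
    ∃ h' ∈ G.nodes j, a :: h' ∈ G.H ∧ a :: h' <:+ h ∧ I = G.cell j h' := by
  induction h with
  | nil => simp [seqSet_nil] at hm
  | cons b h ih =>
    have hn := mem_nodes_of_cons_mem hh
    by_cases hj : G.mover h = j
    · rw [hj] at hn
      rw [seqSet_cons_of_mem_nodes hn, Finset.mem_insert, Prod.mk.injEq] at hm
      rcases hm with ⟨rfl, rfl⟩ | hm
      · exact ⟨h, hn, hh, List.suffix_rfl, rfl⟩
      · obtain ⟨h', hn', hH', hs, hI⟩ := ih (G.tail_mem b h hh) hm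
        exact ⟨h', hn', hH', hs.trans (List.suffix_cons _ _), hI⟩
    · rw [seqSet_cons_of_ne hj] at hm
      obtain ⟨h', hn', hH', hs, hI⟩ := ih (G.tail_mem b h hh) hm
      exact ⟨h', hn', hH', hs.trans (List.suffix_cons _ _), hI⟩

theorem seqSet_eq_empty_or_exists_cons {h : List α} (j : Option N) (hh : h ∈ G.H) :
    G.seqSet j h = ∅ ∨ ∃ h' ∈ G.nodes j, ∃ a, a :: h' ∈ G.H ∧
      G.seqSet j h = G.seqSet j (a :: h') := by
  induction h with
  | nil => exact Or.inl (seqSet_nil j)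
  | cons a h ih =>
    by_cases hj : G.mover h = j
    · exact Or.inr ⟨h, hj ▸ mem_nodes_of_cons_mem hh, a, hh, rfl⟩
    · rw [seqSet_cons_of_ne hj]
      exact ih (G.tail_mem a h hh)

theorem Seq.exists_eq_seqAt {j : Option N} (w : G.Seq j) : ∃ h hh, w = G.seqAt j h hh := by
  obtain ⟨w, hw⟩ := w
  obtain ⟨h, hh, rfl⟩ := Finset.mem_image.1 hw
  exact ⟨h, hh, rfl⟩

end Histories

section PerfectRecall

variable {i : N} {h h' : List α} {a b : α}

theorem actions_eq_of_cell_eq (hh : h ∈ G.nodes (some i)) (hh' : h' ∈ G.nodes (some i))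
    (hc : G.cell (some i) h = G.cell (some i) h') : G.actions h = G.actions h' :=
  G.actions_eq i (G.cell (some i) h) ((G.info i).part_mem.2 hh) h (mem_cell_self hh) h'
    (hc ▸ mem_cell_self hh')

theorem record_eq_of_cell_eq (hG : G.PerfectRecall) (hh : h ∈ G.nodes (some i))
    (hh' : h' ∈ G.nodes (some i)) (hc : G.cell (some i) h = G.cell (some i) h') :
    G.record (some i) h = G.record (some i) h' :=
  hG i (G.cell (some i) h) ((G.info i).part_mem.2 hh) h (mem_cell_self hh) h'
    (hc ▸ mem_cell_self hh')

theorem seqSet_eq_of_cell_eq (hG : G.PerfectRecall) (hh : h ∈ G.nodes (some i))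
    (hh' : h' ∈ G.nodes (some i)) (hc : G.cell (some i) h = G.cell (some i) h') :
    G.seqSet (some i) h = G.seqSet (some i) h' :=
  congrArg List.toFinset (record_eq_of_cell_eq hG hh hh' hc)

-- Otherwise some proper initial history lies in the same information set, with a shorter record.
theorem cell_notMem_seqSet (hG : G.PerfectRecall) (hh : h ∈ G.nodes (some i)) (a : α) :
    (G.cell (some i) h, a) ∉ G.seqSet (some i) h := by
  intro hm
  obtain ⟨h', hh', -, hs, hc⟩ := exists_mem_nodes_of_mem_seqSet (mem_nodes.1 hh).1 hm
  have hlen := (record_suffix (G := G) (some i) hs).length_le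
  rw [record, if_pos (mem_nodes.1 hh').2.2, record_eq_of_cell_eq hG hh hh' hc] at hlen
  simp at hlen

theorem seqSet_cons_subset_seqSet_iff (hG : G.PerfectRecall) (hh : h ∈ G.nodes (some i))
    (hh' : h' ∈ G.H) : G.seqSet (some i) (a :: h) ⊆ G.seqSet (some i) h' ↔
      (G.cell (some i) h, a) ∈ G.seqSet (some i) h' := by
  refine ⟨fun hs => hs (cell_mem_seqSet_cons hh a), fun hm => ?_⟩
  obtain ⟨x, hx, -, hs, hc⟩ := exists_mem_nodes_of_mem_seqSet hh' hm
  rw [seqSet_cons_of_mem_nodes hh, seqSet_eq_of_cell_eq hG hh hx hc, hc,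
    ← seqSet_cons_of_mem_nodes hx]
  exact seqSet_subset_of_suffix _ hs

theorem seqSet_cons_eq_iff (hG : G.PerfectRecall) (hh : h ∈ G.nodes (some i))
    (hh' : h' ∈ G.nodes (some i)) : G.seqSet (some i) (a :: h) = G.seqSet (some i) (b :: h') ↔
      G.cell (some i) h = G.cell (some i) h' ∧ a = b := by
  refine ⟨fun heq => ?_, fun ⟨hc, hab⟩ => ?_⟩
  · have hm := heq ▸ cell_mem_seqSet_cons hh a
    rw [seqSet_cons_of_mem_nodes hh', Finset.mem_insert, Prod.mk.injEq] at hm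
    refine hm.resolve_right fun hm => ?_
    have hsub := (seqSet_cons_subset_seqSet_iff hG hh (mem_nodes.1 hh').1).2 hm
    exact cell_notMem_seqSet hG hh' b (hsub (heq ▸ cell_mem_seqSet_cons hh' b))
  · rw [seqSet_cons_of_mem_nodes hh, seqSet_cons_of_mem_nodes hh', hc, hab,
      seqSet_eq_of_cell_eq hG hh hh' hc]

theorem seqSet_subset_seqSet_cons_iff (hG : G.PerfectRecall) (hh : h ∈ G.nodes (some i))
    (hh' : h' ∈ G.H) : G.seqSet (some i) h' ⊆ G.seqSet (some i) (a :: h) ↔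
      G.seqSet (some i) h' = G.seqSet (some i) (a :: h) ∨
        G.seqSet (some i) h' ⊆ G.seqSet (some i) h := by
  refine ⟨fun hs => ?_, fun hs => hs.elim Eq.subset
    fun hs => hs.trans (seqSet_subset_of_suffix _ (List.suffix_cons a h))⟩
  by_cases hm : (G.cell (some i) h, a) ∈ G.seqSet (some i) h'
  · exact Or.inl (hs.antisymm ((seqSet_cons_subset_seqSet_iff hG hh hh').2 hm))
  · rw [seqSet_cons_of_mem_nodes hh] at hs
    exact Or.inr ((Finset.subset_insert_iff_of_notMem hm).1 hs)

end PerfectRecall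

section Tree

variable {i : N} {h : List α}

variable (G) in
/-- The type of information sets of player `i`. -/
abbrev InfoSet (i : N) : Type _ := {I // I ∈ (G.info i).parts}

/-- The information set of player `i` that contains the history `h`. -/
def infoSetAt (h : List α) (hh : h ∈ G.nodes (some i)) : G.InfoSet i :=
  ⟨G.cell (some i) h, (G.info i).part_mem.2 hh⟩

theorem InfoSet.exists_eq_infoSetAt (I : G.InfoSet i) : ∃ h hh, I = infoSetAt h hh := by
  obtain ⟨h, hh⟩ := (G.info i).nonempty_of_mem_parts I.2
  exact ⟨h, (G.info i).subset I.2 hh, Subtype.ext ((G.info i).part_eq_of_mem I.2 hh).symm⟩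

/-- The sequence `ϖ_I` that leads to the information set `I`, read off an arbitrary history
in `I`. -/
noncomputable def infoSeq (I : G.InfoSet i) : G.Seq (some i) :=
  G.seqAt (some i) I.exists_eq_infoSetAt.choose
    (mem_nodes.1 I.exists_eq_infoSetAt.choose_spec.choose).1

theorem infoSeq_infoSetAt (hG : G.PerfectRecall) (hh : h ∈ G.nodes (some i)) :
    infoSeq (infoSetAt h hh) = G.seqAt (some i) h (mem_nodes.1 hh).1 := by
  obtain ⟨hh', heq⟩ := (infoSetAt h hh).exists_eq_infoSetAt.choose_spec
  exact Subtype.ext (seqSet_eq_of_cell_eq hG hh' hh (congrArg Subtype.val heq).symm)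

open Classical in
/-- The sequences `ϖ_I a` that extend `ϖ_I` by an action `a` at the information set `I`. -/
noncomputable def extensions (I : G.InfoSet i) : Finset (G.Seq (some i)) :=
  {w | ∃ h ∈ I.1, ∃ a, a :: h ∈ G.H ∧ w.1 = G.seqSet (some i) (a :: h)}

theorem mem_extensions_infoSetAt (hG : G.PerfectRecall) (hh : h ∈ G.nodes (some i))
    {w : G.Seq (some i)} : w ∈ extensions (infoSetAt h hh) ↔
      ∃ a, ∃ ha : a ∈ G.actions h, w = G.seqAt (some i) (a :: h) (G.mem_actions.1 ha) := by
  simp only [extensions, Finset.mem_filter, Finset.mem_univ, true_and]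
  constructor
  · rintro ⟨h', hI, a, hH, hw⟩
    have hh' := (G.info i).subset (infoSetAt h hh).2 hI
    have hc : G.cell (some i) h' = G.cell (some i) h :=
      (G.info i).part_eq_of_mem (infoSetAt h hh).2 hI
    exact ⟨a, actions_eq_of_cell_eq hh' hh hc ▸ G.mem_actions.2 hH,
      Subtype.ext (hw.trans ((seqSet_cons_eq_iff hG hh' hh).2 ⟨hc, rfl⟩))⟩
  · rintro ⟨a, ha, rfl⟩
    exact ⟨h, mem_cell_self hh, a, G.mem_actions.1 ha, rfl⟩

theorem mem_extensions_iff (hG : G.PerfectRecall) {I : G.InfoSet i} {w : G.Seq (some i)} :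
    w ∈ extensions I ↔ ∃ h hh a, ∃ ha : a ∈ G.actions h,
      I = infoSetAt h hh ∧ w = G.seqAt (some i) (a :: h) (G.mem_actions.1 ha) := by
  constructor
  · obtain ⟨h, hh, rfl⟩ := I.exists_eq_infoSetAt
    intro hw
    obtain ⟨a, ha, rfl⟩ := (mem_extensions_infoSetAt hG hh).1 hw
    exact ⟨h, hh, a, ha, rfl, rfl⟩
  · rintro ⟨h, hh, a, ha, rfl, rfl⟩
    exact (mem_extensions_infoSetAt hG hh).2 ⟨a, ha, rfl⟩

/-- The decision problem of player `i`: her sequences, ordered by inclusion. -/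
noncomputable def tree (hG : G.PerfectRecall) (i : N) :
    DecisionTree (G.Seq (some i)) (G.InfoSet i) where
  root := G.seqAt (some i) [] G.nil_mem
  par := infoSeq
  kids := extensions
  root_le w := Finset.empty_subset w.1
  le_iff := by
    rintro I w hw x
    obtain ⟨h, hh, a, ha, rfl, rfl⟩ := (mem_extensions_iff hG).1 hw
    obtain ⟨h', hh', rfl⟩ := x.exists_eq_seqAt
    rw [infoSeq_infoSetAt hG, Subtype.ext_iff]
    exact seqSet_subset_seqSet_cons_iff hG hh hh'
  not_le := by
    rintro I w hw hle
    obtain ⟨h, hh, a, ha, rfl, rfl⟩ := (mem_extensions_iff hG).1 hw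
    rw [infoSeq_infoSetAt hG] at hle
    exact cell_notMem_seqSet hG hh a (hle (cell_mem_seqSet_cons hh a))
  exists_kid := by
    intro w hw
    obtain ⟨x, hx, rfl⟩ := w.exists_eq_seqAt
    obtain h0 | ⟨h, hh, a, ha, heq⟩ := seqSet_eq_empty_or_exists_cons (some i) hx
    · exact absurd (Subtype.ext h0) hw
    · exact ⟨infoSetAt h hh, (mem_extensions_iff hG).2
        ⟨h, hh, a, G.mem_actions.2 ha, rfl, Subtype.ext heq⟩⟩
  kids_unique := by
    intro I I' w hw hw'
    obtain ⟨h, hh, a, ha, rfl, rfl⟩ := (mem_extensions_iff hG).1 hw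
    obtain ⟨h', hh', b, hb, rfl, heq⟩ := (mem_extensions_iff hG).1 hw'
    exact Subtype.ext ((seqSet_cons_eq_iff hG hh hh').1 (congrArg Subtype.val heq)).1
  kids_nonempty := by
    intro I
    obtain ⟨h, hh, rfl⟩ := I.exists_eq_infoSetAt
    obtain ⟨a, ha⟩ := (mem_nodes.1 hh).2.1
    exact ⟨_, (mem_extensions_iff hG).2 ⟨h, hh, a, ha, rfl, rfl⟩⟩

theorem sum_extensions_infoSetAt (hG : G.PerfectRecall) (hh : h ∈ G.nodes (some i))
    (f : G.Seq (some i) → ℝ) : ∑ w ∈ extensions (infoSetAt h hh), f w =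
      ∑ a : {a // a ∈ G.actions h}, f (G.seqAt (some i) (a.1 :: h) (G.mem_actions.1 a.2)) := by
  refine (Finset.sum_bij (fun a _ => G.seqAt (some i) (a.1 :: h) (G.mem_actions.1 a.2))
    (fun a _ => (mem_extensions_infoSetAt hG hh).2 ⟨a.1, a.2, rfl⟩) (fun a _ b _ heq => ?_)
    (fun w hw => ?_) fun _ _ => rfl).symm
  · exact Subtype.ext ((seqSet_cons_eq_iff hG hh hh).1 (congrArg Subtype.val heq)).2
  · obtain ⟨a, ha, rfl⟩ := (mem_extensions_infoSetAt hG hh).1 hw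
    exact ⟨⟨a, ha⟩, Finset.mem_univ _, rfl⟩

theorem mem_plans_iff (hG : G.PerfectRecall) {γ : G.Seq (some i) → ℝ} :
    γ ∈ G.plans i ↔ γ (tree hG i).root = 1 ∧ 0 ≤ γ ∧ γ ∈ (tree hG i).flows := by
  refine and_congr Iff.rfl (and_congr Iff.rfl ⟨fun hγ I => ?_, fun hγ h hh => ?_⟩)
  · obtain ⟨h, hh, rfl⟩ := I.exists_eq_infoSetAt
    exact (sum_extensions_infoSetAt hG hh γ).trans
      ((hγ h hh).trans (congrArg γ (infoSeq_infoSetAt hG hh).symm))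
  · rw [← sum_extensions_infoSetAt hG hh γ, ← infoSeq_infoSetAt hG hh]
    exact hγ (infoSetAt h hh)

end Tree

section PureStrategies

variable {i : N}

open Classical in
/-- The sequences that a pure strategy plays: those all of whose actions it prescribes. -/
noncomputable def playedSeqs (s : G.Pure i) : Finset (G.Seq (some i)) := {w | w.1 ⊆ s.1}

theorem mem_playedSeqs {s : G.Pure i} {w : G.Seq (some i)} : w ∈ playedSeqs s ↔ w.1 ⊆ s.1 := by
  simp [playedSeqs]

theorem mem_pureStrategies {s : Finset (Finset (List α) × α)} :
    s ∈ G.pureStrategies i ↔ G.IsPure i s := by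
  simp only [pureStrategies, Finset.mem_filter, Finset.mem_powerset, and_iff_right_iff_imp]
  exact fun h => h.1

theorem mem_moves_iff {m : Finset (List α) × α} :
    m ∈ G.moves i ↔ ∃ h ∈ G.nodes (some i), m.2 :: h ∈ G.H ∧ G.cell (some i) h = m.1 := by
  simp only [moves, Finset.mem_biUnion, Finset.mem_image, Prod.ext_iff, G.mem_actions]
  exact exists_congr fun h => and_congr_right fun _ =>
    ⟨fun ⟨_, ha, hc, hm⟩ => ⟨hm ▸ ha, hc⟩, fun ⟨hm, hc⟩ => ⟨_, hm, hc, rfl⟩⟩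

theorem isPureStrategy_playedSeqs (hG : G.PerfectRecall) (s : G.Pure i) :
    (tree hG i).IsPureStrategy (playedSeqs s) where
  root_mem := mem_playedSeqs.2 (Finset.empty_subset _)
  existsUnique_kid I hI := by
    obtain ⟨hmoves, hs⟩ := mem_pureStrategies.1 s.2
    obtain ⟨h, hh, rfl⟩ := I.exists_eq_infoSetAt
    have hsub : G.seqSet (some i) h ⊆ s.1 := by
      change infoSeq (infoSetAt h hh) ∈ playedSeqs s at hI
      rwa [infoSeq_infoSetAt hG, mem_playedSeqs] at hI
    obtain ⟨a, ha, huniq⟩ := (hs h hh).1 hsub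
    obtain ⟨h', hh', hH, hc⟩ := mem_moves_iff.1 (hmoves ha)
    have haA : a ∈ G.actions h := actions_eq_of_cell_eq hh' hh hc ▸ G.mem_actions.2 hH
    refine ⟨_, ⟨(mem_extensions_infoSetAt hG hh).2 ⟨a, haA, rfl⟩, mem_playedSeqs.2 ?_⟩, ?_⟩
    · exact (seqSet_cons_of_mem_nodes hh a).trans_subset (Finset.insert_subset ha hsub)
    · rintro w ⟨hw, hws⟩
      obtain ⟨b, hb, rfl⟩ := (mem_extensions_infoSetAt hG hh).1 hw
      obtain rfl := huniq b (mem_playedSeqs.1 hws (cell_mem_seqSet_cons hh b))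
      rfl
  par_mem I w hw hws := mem_playedSeqs.2
    (Finset.Subset.trans ((tree hG i).par_lt hw).le (mem_playedSeqs.1 hws))

variable {A : Finset (G.Seq (some i))}

theorem seqAt_cons_mem_of_cell_mem_biUnion (hG : G.PerfectRecall)
    (hA : (tree hG i).IsPureStrategy A) {h : List α} (hh : h ∈ G.nodes (some i)) {a : α}
    (hm : (G.cell (some i) h, a) ∈ A.biUnion Subtype.val) :
    ∃ ha : a ∈ G.actions h, G.seqAt (some i) (a :: h) (G.mem_actions.1 ha) ∈ A := by
  obtain ⟨w, hw, hm⟩ := Finset.mem_biUnion.1 hm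
  obtain ⟨x, hx, rfl⟩ := w.exists_eq_seqAt
  obtain ⟨h', hh', hH, -, hc⟩ := exists_mem_nodes_of_mem_seqSet hx hm
  exact ⟨actions_eq_of_cell_eq hh' hh hc.symm ▸ G.mem_actions.2 hH,
    hA.mem_of_le ((seqSet_cons_subset_seqSet_iff hG hh hx).2 hm) hw⟩

theorem subset_biUnion_iff_mem (hG : G.PerfectRecall) (hA : (tree hG i).IsPureStrategy A)
    {w : G.Seq (some i)} : w.1 ⊆ A.biUnion Subtype.val ↔ w ∈ A := by
  refine ⟨fun hw => ?_, fun hw => Finset.subset_biUnion_of_mem Subtype.val hw⟩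
  by_cases hr : w = (tree hG i).root
  · exact hr ▸ hA.root_mem
  · obtain ⟨I, hI⟩ := (tree hG i).exists_kid w hr
    obtain ⟨h, hh, a, ha, rfl, rfl⟩ := (mem_extensions_iff hG).1 hI
    exact (seqAt_cons_mem_of_cell_mem_biUnion hG hA hh (hw (cell_mem_seqSet_cons hh a))).2

theorem isPure_biUnion (hG : G.PerfectRecall) (hA : (tree hG i).IsPureStrategy A) :
    G.IsPure i (A.biUnion Subtype.val) := by
  refine ⟨fun m hm => ?_, fun h hh => ⟨fun hsub => ?_, fun a hm => ?_⟩⟩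
  · obtain ⟨w, hw, hm⟩ := Finset.mem_biUnion.1 hm
    obtain ⟨x, hx, rfl⟩ := w.exists_eq_seqAt
    obtain ⟨h', hh', hH, -, hc⟩ := exists_mem_nodes_of_mem_seqSet hx hm
    exact mem_moves_iff.2 ⟨h', hh', hH, hc.symm⟩
  · have hpar : infoSeq (infoSetAt h hh) ∈ A :=
      (subset_biUnion_iff_mem hG hA).1 (infoSeq_infoSetAt hG hh ▸ hsub)
    obtain ⟨w, ⟨hw, hwA⟩, huniq⟩ := hA.existsUnique_kid _ hpar
    obtain ⟨a, ha, rfl⟩ := (mem_extensions_infoSetAt hG hh).1 hw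
    refine ⟨a, (subset_biUnion_iff_mem hG hA).2 hwA (cell_mem_seqSet_cons hh a), fun b hm => ?_⟩
    obtain ⟨hb, hbA⟩ := seqAt_cons_mem_of_cell_mem_biUnion hG hA hh hm
    have heq := huniq _ ⟨(mem_extensions_infoSetAt hG hh).2 ⟨b, hb, rfl⟩, hbA⟩
    exact ((seqSet_cons_eq_iff hG hh hh).1 (congrArg Subtype.val heq)).2
  · obtain ⟨ha, haA⟩ := seqAt_cons_mem_of_cell_mem_biUnion hG hA hh hm
    exact (seqSet_subset_of_suffix _ (List.suffix_cons a h)).trans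
      ((subset_biUnion_iff_mem hG hA).2 haA)

theorem exists_playedSeqs_eq (hG : G.PerfectRecall) (hA : (tree hG i).IsPureStrategy A) :
    ∃ s : G.Pure i, playedSeqs s = A :=
  ⟨⟨_, mem_pureStrategies.2 (isPure_biUnion hG hA)⟩,
    Finset.ext fun _ => mem_playedSeqs.trans (subset_biUnion_iff_mem hG hA)⟩

end PureStrategies

section Played

theorem singleton_notMem_seqSet_none {h : List α} (hh : h ∈ G.H) (a : α) :
    ({h}, a) ∉ G.seqSet none h := by
  intro hm
  obtain ⟨h', -, -, hs, hc⟩ := exists_mem_nodes_of_mem_seqSet hh hm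
  obtain rfl : h = h' := Finset.singleton_injective hc
  simpa using hs.length_le

theorem seqSet_cons_subset_iff {j : Option N} {h : List α} {a : α} (hh : a :: h ∈ G.H)
    {t : Finset (Finset (List α) × α)} : G.seqSet j (a :: h) ⊆ t ↔
      G.seqSet j h ⊆ t ∧ (G.mover h = j → (G.cell j h, a) ∈ t) := by
  by_cases hj : G.mover h = j
  · rw [seqSet_cons_of_mem_nodes (hj ▸ mem_nodes_of_cons_mem hh), Finset.insert_subset_iff]
    tauto
  · rw [seqSet_cons_of_ne hj]
    tauto

variable (G) in
/-- The action `b` after the chance history `x` is compatible with `h`: if chance acts after `x`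
along `h`, then it takes `b`. -/
def ChanceCompat (h x : List α) (b : α) : Prop := ∀ a, ({x}, a) ∈ G.seqSet none h → b = a

theorem chanceCompat_nil (x : List α) (b : α) : G.ChanceCompat [] x b := by
  simp [ChanceCompat, seqSet_nil]

theorem chanceCompat_self {h : List α} (hh : h ∈ G.H) (b : α) : G.ChanceCompat h h b :=
  fun a hm => absurd hm (singleton_notMem_seqSet_none hh a)

theorem chanceCompat_cons_iff {h : List α} {a : α} (hh : a :: h ∈ G.H) {x : List α} {b : α} :
    G.ChanceCompat (a :: h) x b ↔
      G.ChanceCompat h x b ∧ (G.mover h = none → x = h → b = a) := by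
  by_cases hj : G.mover h = none
  · simp only [ChanceCompat, seqSet_cons_of_mem_nodes (hj ▸ mem_nodes_of_cons_mem hh),
      Finset.mem_insert, cell, Prod.mk.injEq, Finset.singleton_inj]
    exact ⟨fun H => ⟨fun c hc => H c (Or.inr hc), fun _ hx => H a (Or.inl ⟨hx, rfl⟩)⟩,
      fun H c hc => hc.elim (fun hc => (H.2 hj hc.1).trans hc.2.symm) (H.1 c)⟩
  · simp only [ChanceCompat, seqSet_cons_of_ne hj, hj, false_imp_iff, and_true]

open Classical in
theorem played_eq_ite (s : ∀ i, G.Pure i) (sc : G.ChancePure) {h : List α} (hh : h ∈ G.H) :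
    G.played s sc h = if (∀ j, G.seqSet (some j) h ⊆ (s j).1) ∧
      ∀ x, G.ChanceCompat h x.1 (sc x) then 1 else 0 := by
  induction h with
  | nil => simp [played, seqSet_nil, chanceCompat_nil]
  | cons a h ih =>
    rw [played, ih (G.tail_mem a h hh)]
    simp only [seqSet_cons_subset_iff hh, chanceCompat_cons_iff hh, forall_and]
    have hn := mem_nodes_of_cons_mem hh
    cases hj : G.mover h with
    | none =>
      have hsc : (∀ x : {x // x ∈ G.nodes none}, x.1 = h → (sc x : α) = a) ↔
          ∃ hn, (sc ⟨h, hn⟩ : α) = a :=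
        ⟨fun H => ⟨hj ▸ hn, H ⟨h, hj ▸ hn⟩ rfl⟩, by rintro ⟨_, ha⟩ ⟨x, _⟩ rfl; exact ha⟩
      rw [ite_zero_mul_ite_zero, one_mul]
      simp only [reduceCtorEq, false_imp_iff, forall_const, implies_true, true_and, hsc, and_assoc]
    | some i =>
      rw [ite_zero_mul_ite_zero, one_mul]
      simp only [Option.some.injEq, forall_eq', reduceCtorEq, false_imp_iff, implies_true, and_true,
        and_right_comm]

end Played

section Chance

theorem seqAt_none_cons {h : List α} {a : α} (hh : a :: h ∈ G.H) (hj : G.mover h ≠ none) :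
    G.seqAt none (a :: h) hh = G.seqAt none h (G.tail_mem a h hh) :=
  Subtype.ext (seqSet_cons_of_ne hj a)

theorem chancePlan_seqAt_cons {h : List α} {a : α} (hh : a :: h ∈ G.H) (hj : G.mover h = none) :
    G.chancePlan (G.seqAt none (a :: h) hh) =
      G.chance h a * G.chancePlan (G.seqAt none h (G.tail_mem a h hh)) := by
  simp only [chancePlan, seqAt, seqSet_cons_of_mem_nodes (hj ▸ mem_nodes_of_cons_mem hh), cell]
  rw [Finset.prod_insert (singleton_notMem_seqSet_none (G.tail_mem a h hh) a),
    Finset.prod_singleton]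

variable (G) in
open Classical in
/-- The probability that chance acts compatibly with `h` after the chance history `x`. -/
noncomputable def chanceCompatProb (h x : List α) : ℝ :=
  ∑ a : {a // a ∈ G.actions x}, if G.ChanceCompat h x a then G.chance x a else 0

theorem chanceCompatProb_eq_one {h x : List α} (hx : x ∈ G.nodes none)
    (h_compat : ∀ a, G.ChanceCompat h x a) : G.chanceCompatProb h x = 1 := by
  obtain ⟨hH, hne, hj⟩ := mem_nodes.1 hx
  simp only [chanceCompatProb, h_compat, if_true, ← G.chance_sum x hH hne hj]
  exact Finset.sum_coe_sort (G.actions x) (G.chance x)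

theorem chanceCompatProb_cons_self {h : List α} {a : α} (hh : a :: h ∈ G.H)
    (hj : G.mover h = none) : G.chanceCompatProb (a :: h) h = G.chance h a := by
  simp only [chanceCompatProb, chanceCompat_cons_iff hh, chanceCompat_self (G.tail_mem a h hh), hj,
    true_and, forall_const]
  rw [Finset.sum_eq_single_of_mem ⟨a, G.mem_actions.2 hh⟩ (Finset.mem_univ _) fun b _ hb =>
    if_neg fun hba => hb (Subtype.ext hba), if_pos rfl]

theorem chanceCompatProb_cons_of_ne {h x : List α} {a : α} (hh : a :: h ∈ G.H)
    (hx : G.mover h = none → x ≠ h) : G.chanceCompatProb (a :: h) x = G.chanceCompatProb h x := by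
  classical
  exact Finset.sum_congr rfl fun b _ => if_congr ((chanceCompat_cons_iff hh).trans
    (and_iff_left fun hj hxh => absurd hxh (hx hj))) rfl rfl

theorem prod_chanceCompatProb {h : List α} (hh : h ∈ G.H) :
    ∏ x ∈ G.nodes none, G.chanceCompatProb h x = G.chancePlan (G.seqAt none h hh) := by
  induction h with
  | nil =>
    rw [Finset.prod_eq_one fun x hx => chanceCompatProb_eq_one hx (chanceCompat_nil x)]
    rfl
  | cons a h ih =>
    have hH := G.tail_mem a h hh
    by_cases hj : G.mover h = none
    · have hn : h ∈ G.nodes none := hj ▸ mem_nodes_of_cons_mem hh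
      rw [chancePlan_seqAt_cons hh hj, ← ih hH, ← Finset.mul_prod_erase _ _ hn,
        ← Finset.mul_prod_erase _ (G.chanceCompatProb h) hn, chanceCompatProb_cons_self hh hj,
        chanceCompatProb_eq_one hn (chanceCompat_self hH), one_mul]
      congr 1
      exact Finset.prod_congr rfl fun x hx =>
        chanceCompatProb_cons_of_ne hh fun _ => Finset.ne_of_mem_erase hx
    · rw [seqAt_none_cons hh hj, ← ih hH]
      exact Finset.prod_congr rfl fun x _ =>
        chanceCompatProb_cons_of_ne hh fun hj' => absurd hj' hj

open Classical in
theorem sum_chanceMixed_mul_ite {h : List α} (hh : h ∈ G.H) :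
    ∑ sc : G.ChancePure, G.chanceMixed sc * (if ∀ x, G.ChanceCompat h x.1 (sc x) then 1 else 0) =
      G.chancePlan (G.seqAt none h hh) := by
  rw [← prod_chanceCompatProb hh, ← Finset.prod_coe_sort]
  simp only [chanceCompatProb]
  rw [Finset.prod_univ_sum, Fintype.piFinset_univ]
  refine Finset.sum_congr rfl fun sc _ => ?_
  rw [Finset.prod_ite_zero, mul_ite, mul_one, mul_zero]
  simp only [Finset.mem_univ, forall_const, chanceMixed]

end Chance

section Payoffs

variable (G) in
/-- The type of terminal histories. -/
abbrev Terminal : Type _ := {h // h ∈ G.Z}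

/-- The sequence profile that a terminal history defines. -/
def Terminal.seq (z : G.Terminal) (j : Option N) : G.Seq j :=
  G.seqAt j z.1 (Finset.mem_filter.1 z.2).1

theorem Terminal.sum_eq (f : List α → ℝ) : ∑ h ∈ G.Z, f h = ∑ z : G.Terminal, f z.1 :=
  (Finset.sum_coe_sort G.Z f).symm

theorem inducedPlan_eq_realization (σ : G.MixedProfile) (i : N) :
    G.inducedPlan σ i = realization playedSeqs (σ i) := by
  classical
  ext w
  simp only [inducedPlan, realization_apply, Finset.sum_filter, mem_playedSeqs, ite_mul, one_mul,
    zero_mul]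

open Classical in
theorem seqPayoff_eq_sum_ite (i : N) (w : ∀ j, G.Seq j) :
    G.seqPayoff i w = ∑ z : G.Terminal, if w = z.seq then G.payoff i z.1 else 0 := by
  rw [seqPayoff, Finset.sum_filter, Terminal.sum_eq]
  refine Finset.sum_congr rfl fun z _ => if_congr ?_ rfl rfl
  simp only [funext_iff, Subtype.ext_iff]
  rfl

variable [Fintype N]

/-- The probability that chance and the players other than `i` take all their actions along the
terminal history `z`. -/
noncomputable def reachProb (i : N) (γ : G.PlanProfile) (z : G.Terminal) : ℝ :=
  ∏ j ∈ Finset.univ.erase (some i), G.withChance γ j (z.seq j)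

theorem reachProb_eq_chancePlan_mul (i : N) (γ : G.PlanProfile) (z : G.Terminal) :
    reachProb i γ z =
      G.chancePlan (z.seq none) * ∏ j ∈ Finset.univ.erase i, γ j (z.seq (some j)) := by
  have hset : (Finset.univ.erase (some i) : Finset (Option N)) =
      Finset.insertNone (Finset.univ.erase i) := by
    ext j; cases j <;> simp
  rw [reachProb, hset, Finset.prod_insertNone]
  rfl

theorem seqExpPayoff_eq_sum_ite (i : N) (w : G.Seq (some i)) (γ : G.PlanProfile) :
    G.seqExpPayoff i w γ =
      ∑ z : G.Terminal, if z.seq (some i) = w then G.payoff i z.1 * reachProb i γ z else 0 := by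
  simp only [seqExpPayoff, seqPayoff_eq_sum_ite, Finset.sum_mul, ite_mul, zero_mul]
  rw [Finset.sum_comm]
  simp only [Finset.sum_ite_eq', Finset.mem_filter, Finset.mem_univ, true_and, reachProb]

theorem sum_played_mul_chanceMixed (s : ∀ j, G.Pure j) (z : G.Terminal) :
    ∑ sc : G.ChancePure, G.played s sc z.1 * G.chanceMixed sc =
      (if ∀ j, z.seq (some j) ∈ playedSeqs (s j) then 1 else 0) * G.chancePlan (z.seq none) := by
  have hz := (Finset.mem_filter.1 z.2).1
  have hs : (∀ j, z.seq (some j) ∈ playedSeqs (s j)) ↔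
      ∀ j, G.seqSet (some j) z.1 ⊆ (s j).1 := forall_congr' fun _ => mem_playedSeqs
  change _ = _ * G.chancePlan (G.seqAt none z.1 hz)
  rw [← sum_chanceMixed_mul_ite hz, Finset.mul_sum]
  refine Finset.sum_congr rfl fun sc _ => ?_
  rw [played_eq_ite s sc hz, ite_and, mul_comm, mul_left_comm, ite_mul, one_mul, zero_mul]
  simp only [hs]
  congr

theorem sum_ite_mem_playedSeqs_mul_prod (i : N) (s : G.Pure i) (σ : G.MixedProfile)
    (w : ∀ j, G.Seq (some j)) :
    ∑ t : (∀ j, G.Pure j) with t i = s,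
      (if ∀ j, w j ∈ playedSeqs (t j) then 1 else 0) * ∏ j ∈ Finset.univ.erase i, σ j (t j) =
    (if w i ∈ playedSeqs s then 1 else 0) *
      ∏ j ∈ Finset.univ.erase i, G.inducedPlan σ j (w j) := by
  let f (j : N) (c : G.Pure j) : ℝ :=
    (if w j ∈ playedSeqs c then 1 else 0) * if j = i then 1 else σ j c
  have hf {j : N} (hj : j ∈ Finset.univ.erase i) (c : G.Pure j) :
      f j c = if w j ∈ playedSeqs c then σ j c else 0 := by
    simp only [f, if_neg (Finset.ne_of_mem_erase hj), ite_mul, one_mul, zero_mul]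
  have hf_self (c : G.Pure i) : f i c = if w i ∈ playedSeqs c then 1 else 0 := by
    simp only [f, if_pos, mul_one]
  have hprod (t : ∀ j, G.Pure j) : ∏ j, f j (t j) =
      (if ∀ j, w j ∈ playedSeqs (t j) then 1 else 0) * ∏ j ∈ Finset.univ.erase i, σ j (t j) := by
    rw [Finset.prod_mul_distrib, Finset.prod_ite_zero, Finset.prod_const_one,
      ← Finset.mul_prod_erase Finset.univ _ (Finset.mem_univ i), if_pos rfl, one_mul]
    simp only [Finset.mem_univ, forall_const]
    congr 1
    exact Finset.prod_congr rfl fun j hj => if_neg (Finset.ne_of_mem_erase hj)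
  simp only [← hprod]
  refine (sum_prod_filter_apply_eq f i s).trans ?_
  rw [hf_self]
  congr 1
  refine Finset.prod_congr rfl fun j hj => ?_
  rw [inducedPlan_eq_realization, realization_apply, Finset.sum_filter]
  exact Finset.sum_congr rfl fun c _ => hf hj c

theorem mixedPayoff_eq_sum_ite (i : N) (s : G.Pure i) (σ : G.MixedProfile) :
    G.mixedPayoff i s σ = ∑ z : G.Terminal, if z.seq (some i) ∈ playedSeqs s then
      G.payoff i z.1 * reachProb i (G.inducedPlan σ) z else 0 := by
  classical
  calc G.mixedPayoff i s σ
    _ = ∑ t : (∀ j, G.Pure j) with t i = s, ∑ z : G.Terminal, G.payoff i z.1 *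
          (∑ sc, G.played t sc z.1 * G.chanceMixed sc) * ∏ j ∈ Finset.univ.erase i, σ j (t j) := by
      simp only [mixedPayoff, purePayoff, Terminal.sum_eq, Finset.sum_mul, Finset.mul_sum]
      refine Finset.sum_congr rfl fun t _ => Finset.sum_comm.trans ?_
      simp only [mul_assoc]
    _ = ∑ z : G.Terminal, G.payoff i z.1 * (G.chancePlan (z.seq none) *
          ∑ t : (∀ j, G.Pure j) with t i = s, (if ∀ j, z.seq (some j) ∈ playedSeqs (t j) then 1
            else 0) * ∏ j ∈ Finset.univ.erase i, σ j (t j)) := by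
      simp only [sum_played_mul_chanceMixed, Finset.mul_sum]
      rw [Finset.sum_comm]
      refine Finset.sum_congr rfl fun z _ => Finset.sum_congr rfl fun t _ => ?_
      ring
    _ = _ := by
      refine Finset.sum_congr rfl fun z _ => ?_
      rw [sum_ite_mem_playedSeqs_mul_prod i s σ fun j => z.seq (some j),
        reachProb_eq_chancePlan_mul, mul_left_comm (G.chancePlan _), ite_mul, one_mul, zero_mul,
        mul_ite, mul_zero]

theorem mixedPayoff_eq_sum_seqExpPayoff (i : N) (s : G.Pure i) (σ : G.MixedProfile) :
    G.mixedPayoff i s σ = ∑ w ∈ playedSeqs s, G.seqExpPayoff i w (G.inducedPlan σ) := by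
  simp only [mixedPayoff_eq_sum_ite, seqExpPayoff_eq_sum_ite]
  rw [Finset.sum_comm]
  simp only [Finset.sum_ite_eq]

end Payoffs

section Equilibria

theorem continuous_inducedPlan : Continuous G.inducedPlan := by
  unfold inducedPlan
  fun_prop

theorem inducedPlan_mem_planProfiles (hG : G.PerfectRecall) {σ : G.MixedProfile}
    (hσ : σ ∈ G.mixedProfiles) : G.inducedPlan σ ∈ G.planProfiles := fun i => by
  rw [inducedPlan_eq_realization, mem_plans_iff hG]
  exact ⟨(DecisionTree.realization_root (isPureStrategy_playedSeqs hG) _).trans (hσ i).2,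
    realization_nonneg (hσ i).1,
    DecisionTree.realization_mem_flows (isPureStrategy_playedSeqs hG) _⟩

theorem inducedPlan_pos (hG : G.PerfectRecall) {σ : G.MixedProfile} (hσ : ∀ i s, 0 < σ i s)
    (i : N) (w : G.Seq (some i)) : 0 < G.inducedPlan σ i w := by
  obtain ⟨_, hS, hw, -⟩ :=
    (tree hG i).exists_isPureStrategy w (fun _ => True) (fun _ _ => trivial)
      fun j _ _ => ((tree hG i).kids_nonempty j).imp fun _ hx => ⟨hx, trivial⟩
  obtain ⟨s, rfl⟩ := exists_playedSeqs_eq hG hS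
  rw [inducedPlan_eq_realization]
  exact (hσ i s).trans_le (le_realization (fun t => (hσ i t).le) hw)

theorem indicator_mem_plans (hG : G.PerfectRecall) {i : N} {S : Finset (G.Seq (some i))}
    (hS : (tree hG i).IsPureStrategy S) :
    (S : Set (G.Seq (some i))).indicator 1 ∈ G.plans i :=
  (mem_plans_iff hG).2 ⟨Set.indicator_of_mem (Finset.mem_coe.2 hS.root_mem) _,
    Set.indicator_nonneg fun _ _ => zero_le_one, hS.indicator_mem_flows⟩

variable [Fintype N]

theorem IsEpsNormalFormProper.mono {ε ε' : ℝ} (h : ε ≤ ε') {σ : G.MixedProfile}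
    (hσ : G.IsEpsNormalFormProper ε σ) : G.IsEpsNormalFormProper ε' σ :=
  ⟨hσ.1, hσ.2.1, fun i s s' hlt => (hσ.2.2 i s s' hlt).trans
    (mul_le_mul_of_nonneg_right h (hσ.2.1 i s').le)⟩

theorem IsEpsSequenceFormProper.mono {ε ε' : ℝ} (h : ε ≤ ε') {γ : G.PlanProfile}
    (hγ : G.IsEpsSequenceFormProper ε γ) : G.IsEpsSequenceFormProper ε' γ :=
  ⟨hγ.1, hγ.2.1, fun i w w' hlt => (hγ.2.2 i w w' hlt).trans
    (mul_le_mul_of_nonneg_right h (hγ.2.1 i w').le)⟩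

theorem isNormalFormProper_iff {σ : G.MixedProfile} : G.IsNormalFormProper σ ↔
    σ ∈ G.mixedProfiles ∧ ∀ ε > 0, ∃ᶠ τ in 𝓝 σ, G.IsEpsNormalFormProper ε τ :=
  and_congr_right fun _ => exists_mapClusterPt_iff_frequently fun _ _ _ h hσ => hσ.mono h

theorem isSequenceFormProper_iff {γ : G.PlanProfile} : G.IsSequenceFormProper γ ↔
    γ ∈ G.planProfiles ∧ ∀ ε > 0, ∃ᶠ η in 𝓝 γ, G.IsEpsSequenceFormProper ε η :=
  and_congr_right fun _ => exists_mapClusterPt_iff_frequently fun _ _ _ h hγ => hγ.mono h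

theorem exists_isLoss_payoff_eq (hG : G.PerfectRecall) (i : N) (γ : G.PlanProfile) :
    ∃ (V : ℝ) (L : G.Seq (some i) → ℝ), (tree hG i).IsLoss L ∧
      (∀ w, G.maxPayoff i w γ = V - DecisionTree.pathLoss L w) ∧
      ∀ s : G.Pure i, ∑ w ∈ playedSeqs s, G.seqExpPayoff i w γ = V - ∑ w ∈ playedSeqs s, L w := by
  obtain ⟨V, L, hL, h⟩ := (tree hG i).exists_isLoss_sum_mul_eq fun w => G.seqExpPayoff i w γ
  have hplan : ∀ ρ ∈ G.plans i, G.planPayoff i ρ γ = V - ∑ w, ρ w * L w := fun ρ hρ => by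
    obtain ⟨h1, -, hflow⟩ := (mem_plans_iff hG).1 hρ
    rw [planPayoff, h ρ hflow, h1, mul_one]
  have hpure {S} (hS : (tree hG i).IsPureStrategy S) :
      ∑ w ∈ S, G.seqExpPayoff i w γ = V - ∑ w ∈ S, L w := by
    simpa only [planPayoff, sum_indicator_one_mul] using hplan _ (indicator_mem_plans hG hS)
  refine ⟨V, L, hL, fun w => IsGreatest.csSup_eq ⟨?_, ?_⟩,
    fun s => hpure (isPureStrategy_playedSeqs hG s)⟩
  · obtain ⟨S, hS, hw, hsum⟩ := hL.exists_isPureStrategy_sum_eq w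
    refine ⟨_, ⟨indicator_mem_plans hG hS, Set.indicator_of_mem (Finset.mem_coe.2 hw) _⟩, ?_⟩
    rw [← hsum, ← hpure hS]
    exact sum_indicator_one_mul S _
  · rintro _ ⟨ρ, ⟨hρ, hw⟩, rfl⟩
    obtain ⟨-, h0, hflow⟩ := (mem_plans_iff hG).1 hρ
    exact (hplan ρ hρ).trans_le (sub_le_sub_left (hL.pathLoss_le_sum_mul hflow h0 hw) V)

theorem exists_isLoss_forall_isEpsProper_iff (hG : G.PerfectRecall) (i : N) (γ : G.PlanProfile) :
    ∃ L : G.Seq (some i) → ℝ, (tree hG i).IsLoss L ∧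
      (∀ ε (ρ : G.Seq (some i) → ℝ), IsEpsProper ε (DecisionTree.pathLoss L) ρ ↔
        ∀ w w', G.maxPayoff i w γ < G.maxPayoff i w' γ → ρ w ≤ ε * ρ w') ∧
      ∀ σ, G.inducedPlan σ = γ →
        ∀ ε (τ : G.Pure i → ℝ), IsEpsProper ε (fun s => ∑ w ∈ playedSeqs s, L w) τ ↔
          ∀ s s', G.mixedPayoff i s σ < G.mixedPayoff i s' σ → τ s ≤ ε * τ s' := by
  obtain ⟨V, L, hL, hmax, hpure⟩ := exists_isLoss_payoff_eq hG i γ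
  refine ⟨L, hL, fun _ _ => isEpsProper_iff_of_eq_sub hmax, ?_⟩
  rintro σ rfl ε τ
  exact isEpsProper_iff_of_eq_sub fun s => (mixedPayoff_eq_sum_seqExpPayoff i s σ).trans (hpure s)

theorem IsEpsNormalFormProper.inducedPlan (hG : G.PerfectRecall) {δ ε : ℝ} (hδ : 0 ≤ δ)
    (hδε : ∀ i, Fintype.card (G.Pure i) * δ ≤ ε) {σ : G.MixedProfile}
    (hσ : G.IsEpsNormalFormProper δ σ) : G.IsEpsSequenceFormProper ε (G.inducedPlan σ) := by
  have hpos := inducedPlan_pos hG hσ.2.1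
  refine ⟨inducedPlan_mem_planProfiles hG hσ.1, hpos, fun i => ?_⟩
  obtain ⟨L, hL, hseq, hnormal⟩ := exists_isLoss_forall_isEpsProper_iff hG i (G.inducedPlan σ)
  have hproper := DecisionTree.isEpsProper_realization hL (isPureStrategy_playedSeqs hG)
    (fun _ hS => exists_playedSeqs_eq hG hS) (hσ.1 i).1 hδ ((hnormal σ rfl δ _).2 (hσ.2.2 i))
  rw [← inducedPlan_eq_realization] at hproper
  exact (hseq ε _).1 (hproper.mono (hδε i) fun w => (hpos i w).le)

theorem IsNormalFormProper.inducedPlan (hG : G.PerfectRecall) {σ : G.MixedProfile}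
    (hσ : G.IsNormalFormProper σ) : G.IsSequenceFormProper (G.inducedPlan σ) := by
  obtain ⟨hσ, hfreq⟩ := isNormalFormProper_iff.1 hσ
  refine isSequenceFormProper_iff.2 ⟨inducedPlan_mem_planProfiles hG hσ, fun ε hε => ?_⟩
  have hcard : ∀ i, ∀ᶠ δ : ℝ in 𝓝 0, Fintype.card (G.Pure i) * δ ≤ ε := fun i =>
    ((continuous_const_mul (Fintype.card (G.Pure i) : ℝ)).tendsto' 0 0
      (mul_zero _)).eventually_le_const hε
  obtain ⟨δ, hδε, hδ⟩ := ((eventually_all.2 hcard).filter_mono nhdsWithin_le_nhds |>.and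
    (eventually_mem_nhdsWithin (s := Set.Ioi 0))).exists
  exact continuous_inducedPlan.continuousAt.frequently
    ((hfreq δ hδ).mono fun τ hτ => hτ.inducedPlan hG (Set.mem_Ioi.1 hδ).le hδε)

theorem exists_forall_isEpsSequenceFormProper_imp (hG : G.PerfectRecall) {σ : G.MixedProfile}
    (hσ : σ ∈ G.mixedProfiles) {i : N} {U : Set (G.Pure i → ℝ)} (hU : U ∈ 𝓝 (σ i)) {ε : ℝ}
    (hε : 0 < ε) : ∃ δ > 0, ∀ᶠ γ in 𝓝 (G.inducedPlan σ), G.IsEpsSequenceFormProper δ γ →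
      ∃ τ ∈ U, (∀ s, 0 < τ s) ∧ realization playedSeqs τ = γ i ∧ ∀ σ', G.inducedPlan σ' = γ →
        ∀ s s', G.mixedPayoff i s σ' < G.mixedPayoff i s' σ' → τ s ≤ ε * τ s' := by
  obtain ⟨δ, hδ, hev⟩ := DecisionTree.exists_forall_isEpsProper_realization_eq
    (isPureStrategy_playedSeqs hG) (fun _ hS => exists_playedSeqs_eq hG hS) (hσ i) hU hε
  rw [← inducedPlan_eq_realization] at hev
  refine ⟨δ, hδ, ((continuous_apply i).continuousAt.eventually hev).mono fun γ hγ hproper => ?_⟩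
  obtain ⟨L, hL, hseq, hnormal⟩ := exists_isLoss_forall_isEpsProper_iff hG i γ
  obtain ⟨hroot, -, hflow⟩ := (mem_plans_iff hG).1 (hproper.1 i)
  obtain ⟨τ, hτU, hτpos, hτ, hτproper⟩ :=
    hγ L hL hflow hroot (hproper.2.1 i) ((hseq δ _).2 (hproper.2.2 i))
  exact ⟨τ, hτU, hτpos, hτ, fun σ' hσ' => (hnormal σ' hσ' ε τ).1 hτproper⟩

theorem isNormalFormProper_of_inducedPlan (hG : G.PerfectRecall) {σ : G.MixedProfile}
    (hσ : σ ∈ G.mixedProfiles) (h : G.IsSequenceFormProper (G.inducedPlan σ)) :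
    G.IsNormalFormProper σ := by
  refine isNormalFormProper_iff.2 ⟨hσ, fun ε hε => frequently_iff.2 fun {U} hU => ?_⟩
  rw [nhds_pi, mem_pi] at hU
  obtain ⟨_, -, V, hV, hVU⟩ := hU
  choose δ hδ hlift using fun i => exists_forall_isEpsSequenceFormProper_imp hG hσ (hV i) hε
  obtain ⟨δ₀, hδ₀, hδ₀_pos⟩ : ∃ δ₀, (∀ i, δ₀ ∈ Set.Ioc 0 (δ i)) ∧ δ₀ ∈ Set.Ioi (0 : ℝ) :=
    ((eventually_all.2 fun i => Ioc_mem_nhdsGT (hδ i)).and eventually_mem_nhdsWithin).exists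
  obtain ⟨γ, hγ, hlift⟩ := (((isSequenceFormProper_iff.1 h).2 δ₀ hδ₀_pos).and_eventually
    (eventually_all.2 hlift)).exists
  choose τ hτV hτpos hτ hτproper using fun i => hlift i (hγ.mono (hδ₀ i).2)
  have hind : G.inducedPlan τ = γ :=
    funext fun i => (inducedPlan_eq_realization τ i).trans (hτ i)
  have hsum (i : N) : ∑ s, τ i s = 1 := by
    rw [← DecisionTree.realization_root (isPureStrategy_playedSeqs hG), hτ i]
    exact ((mem_plans_iff hG).1 (hγ.1 i)).1
  exact ⟨τ, hVU fun i _ => hτV i, ⟨fun i => ⟨fun s => (hτpos i s).le, hsum i⟩, hτpos,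
    fun i => hτproper i τ hind⟩⟩

end Equilibria

end ExtensiveGame

theorem theorem2 {N α : Type*} [Fintype N] [DecidableEq N] [DecidableEq α]
    (G : ExtensiveGame N α) (hG : G.PerfectRecall)
    (σ : G.MixedProfile) (γ : G.PlanProfile) (hT : (σ, γ) ∈ G.inducedPairs) :
    G.IsNormalFormProper σ ↔ G.IsSequenceFormProper γ := by
  obtain ⟨hσ, rfl⟩ : σ ∈ G.mixedProfiles ∧ γ = G.inducedPlan σ := hT
  exact ⟨fun h => h.inducedPlan hG, ExtensiveGame.isNormalFormProper_of_inducedPlan hG hσ⟩
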